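/- **Setup.** Let $\mathcal X\subset\mathbb R^d$ be compact, let $\theta^L,\theta^U\in\mathbb R^d$ with $0<\theta^L_i\le\theta^U_i$ for all $i$, let $\sigma>0$ and $\alpha\in(0,1]$. For $\theta\in(0,\infty)^d$ let $k^\theta(x,x')=\exp\bigl(-\tfrac12\sum_i (x_i-x_i')^2/\theta_i^2\bigr)$ be the squared exponential kernel. Let $f$ belong to the reproducing kernel Hilbert space $\mathcal H_{\theta^U}$ of $k^{\theta^U}$ on $\mathcal X$, and let $x^\star\in\arg\max_{\mathcal X}f$. Given data $(x_s,y_s)_{s\le t}$, put $K_t=[k^\theta(x_i,x_j)]_{i,j\le t}$, $k_t(x)=[k^\theta(x_i,x)]_{i\le t}$ and define the $\alpha$-tempered posterior mean and variance by $$\mu_{t,\alpha}(x;\theta)=k_t(x)^\top\bigl(K_t+\tfrac{\sigma^2}{\alpha}I\bigr)^{-1}y_{1:t},\qquad \sigma_{t,\alpha}^2(x;\theta)=k^\theta(x,x)-k_t(x)^\top\bigl(K_t+\tfrac{\sigma^2}{\alpha}I\bigr)^{-1}k_t(x).$$ For $g\ge0$ let $\tau_g(v)=\int_v^\infty(u-v)^g\phi(u)\,du$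 with $\phi$ the standard normal density, let $\tau_g^{-1}$ be its inverse function, and let $C_{(g)}=\frac{2^{g/2}\Gamma((g+1)/2)}{2\sqrt\pi}$. Let $\gamma_{t,\alpha}^\theta=\max\tfrac12\log\det(I+\alpha\sigma^{-2}K_A^\theta)$ over all choices $A$ of $t$ points of $\mathcal X$, repetitions allowed, where $K^\theta_A$ is the kernel matrix of $A$. For $\delta\in(0,1)$ and $t\ge1$ let $$m_{\alpha,t}^{\theta}=\sqrt\alpha\Bigl(\sqrt{\gamma_{t-1,\alpha}^{\theta}}+\sqrt{\log\tfrac{2t^2\pi^2}{3\delta}}\Bigr).$$ **Algorithm.** In each round $t=1,2,\dots$, length-scales $\theta_t$ with $\theta^L\le\theta_t\le\theta^U$ (componentwise) and a number $\nu_t>0$ are chosen from the past, possibly at random. The number $\nu_t$ is of the same order as $m_{\alpha,t}^{\theta_t}$, i.e. $m_{\alpha,t}^{\theta_t}/\nu_t\le C_1$ and $\nu_t\le C_0\,m_{\alpha,t}^{\theta_t}$ with constants $C_0,C_1>0$. The query point $x_t$ is chosen (also from the past) as a maximizer over $x\in\mathcal X$ of the rescaled $g$-EI acquisition function $$\nu_t^{g}\,\sigma_{t-1,\alpha}(x;\theta_t)^{g}\,\tau_g\!\left(\frac{\mu_t^+-\mu_{t-1,\alpha}(x;\theta_t)}{\nu_t\,\sigma_{t-1,\alpha}(x;\theta_t)}\right),\qquad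 \mu_t^+=\max_{z\in\mathcal X}\mu_{t-1,\alpha}(z;\theta_t),$$ and $y_t=f(x_t)+\varepsilon_t$ is observed, where $\varepsilon_t\sim\mathcal N(0,\sigma^2)$ is independent of the past. Let $R_T=\sum_{t=1}^T\bigl(f(x^\star)-f(x_t)\bigr)$. **Theorem (tempered GP regret, $0\le g<1$).** Let $0\le g<1$ (so that $g=0$, probability of improvement, is included). There is a constant $C_g'>0$, depending only on $g$, such that the following holds in every setup as above. Put $C_2=\prod_{i=1}^d\theta_i^U/\theta_i^L$ and, for $T\ge1$, $$\eta_{\alpha,g,T}=C_g'\,\bigl(m_{\alpha,T}^{\theta^L}\bigr)^g\Bigl(\frac{\sigma^2}{\alpha(T-1)+\sigma^2}\Bigr)^{(g-1)/2},$$ $$\beta_{T,\alpha,g}=\sqrt{2C_2}\,\|f\|_{\mathcal H_{\theta^U}}+\Bigl[2\sqrt2+C_1\,\tau_g^{-1}\Bigl(C_{(g)}\Bigl(\frac{\sigma^2}{\alpha(T-1)+\sigma^2}\Bigr)^{g/2}\Bigr)\Bigr]m_{\alpha,T}^{\theta^L}+\eta_{\alpha,g,T}.$$ Then, with probability at least $1-\delta$,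 $$R_T=\mathcal O\Bigl(\beta_{T,\alpha,g}\sqrt{\gamma_{T,\alpha}^{\theta^L}\,T/\alpha}\Bigr).$$ More precisely: for every $B$ there is a constant $C>0$, depending only on $g$, $d$, $\mathcal X$, $\theta^L$, $\theta^U$, $\sigma$, $\alpha$, $C_0$, $C_1$ and $B$ (not on $T$, $\delta$, the outcome, the choices of the algorithm, or $f$ beyond $\|f\|_{\mathcal H_{\theta^U}}\le B$), such that whenever $\|f\|_{\mathcal H_{\theta^U}}\le B$, with probability at least $1-\delta$ one has $R_T\le C\,\beta_{T,\alpha,g}\sqrt{\gamma_{T,\alpha}^{\theta^L}T/\alpha}$ for all $T\ge1$ simultaneously. -/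

import Mathlib

open MeasureTheory ProbabilityTheory
open scoped Matrix

noncomputable section

namespace TemperedBO

/-- The squared exponential kernel with length-scales `θ`,
`k^θ(x, y) = exp (-(1/2) (x - y)ᵀ diag(θ²)⁻¹ (x - y))`. -/
def seKernel {d : ℕ} (θ : Fin d → ℝ) (x y : EuclideanSpace ℝ (Fin d)) : ℝ :=
  Real.exp (-(1 / 2) * ∑ i, (x i - y i) ^ 2 / (θ i) ^ 2)

/-- The kernel matrix `K = [k^θ(x_i, x_j)]` of the points `x_1, …, x_n`. -/
def kernelMatrix {d n : ℕ} (θ : Fin d → ℝ) (x : Fin n → EuclideanSpace ℝ (Fin d)) :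
    Matrix (Fin n) (Fin n) ℝ :=
  Matrix.of fun i j => seKernel θ (x i) (x j)

/-- The vector `[k^θ(x_1, z), …, k^θ(x_n, z)]ᵀ`. -/
def kernelVec {d n : ℕ} (θ : Fin d → ℝ) (x : Fin n → EuclideanSpace ℝ (Fin d))
    (z : EuclideanSpace ℝ (Fin d)) : Fin n → ℝ :=
  fun i => seKernel θ (x i) z

/-- The inverse `(K + (σ²/α) I)⁻¹` that occurs in the `α`-tempered posterior. -/
def temperedInv {d n : ℕ} (σ α : ℝ) (θ : Fin d → ℝ) (x : Fin n → EuclideanSpace ℝ (Fin d)) :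
    Matrix (Fin n) (Fin n) ℝ :=
  (kernelMatrix θ x + (σ ^ 2 / α) • (1 : Matrix (Fin n) (Fin n) ℝ))⁻¹

/-- The `α`-tempered posterior mean at `z`, given the data `(x_i, y_i)`, `i = 1, …, n`. -/
def postMean {d n : ℕ} (σ α : ℝ) (θ : Fin d → ℝ) (x : Fin n → EuclideanSpace ℝ (Fin d))
    (y : Fin n → ℝ) (z : EuclideanSpace ℝ (Fin d)) : ℝ :=
  kernelVec θ x z ⬝ᵥ (temperedInv σ α θ x *ᵥ y)

/-- The `α`-tempered posterior covariance of the values at `z` and `z'`. -/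
def postCov {d n : ℕ} (σ α : ℝ) (θ : Fin d → ℝ) (x : Fin n → EuclideanSpace ℝ (Fin d))
    (z z' : EuclideanSpace ℝ (Fin d)) : ℝ :=
  seKernel θ z z' - kernelVec θ x z ⬝ᵥ (temperedInv σ α θ x *ᵥ kernelVec θ x z')

/-- The `α`-tempered posterior standard deviation at `z`. -/
def postStd {d n : ℕ} (σ α : ℝ) (θ : Fin d → ℝ) (x : Fin n → EuclideanSpace ℝ (Fin d))
    (z : EuclideanSpace ℝ (Fin d)) : ℝ :=
  √(postCov σ α θ x z z)

/-- `μ⁺`, the maximum over the search domain `X` of the tempered posterior mean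
(attained when `X` is compact and non-empty). -/
def maxPostMean {d n : ℕ} (X : Set (EuclideanSpace ℝ (Fin d))) (σ α : ℝ) (θ : Fin d → ℝ)
    (x : Fin n → EuclideanSpace ℝ (Fin d)) (y : Fin n → ℝ) : ℝ :=
  sSup (postMean σ α θ x y '' X)

/-- `τ_g(v) = ∫_v^∞ (u - v)^g φ(u) du`, where `φ` is the standard normal density. -/
def tau (g v : ℝ) : ℝ :=
  ∫ u in Set.Ioi v, (u - v) ^ g * gaussianPDFReal 0 1 u

/-- The inverse function of `τ_g` (which is strictly decreasing on `ℝ` for `g ≥ 0`). -/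
def tauInv (g : ℝ) : ℝ → ℝ :=
  Function.invFun (tau g)

/-- The rescaled `g`-EI acquisition function `ν^g σ(z)^g τ_g(v / ν)` with
`v = (μ⁺ - μ(z)) / σ(z)`. -/
def acquisition {d n : ℕ} (X : Set (EuclideanSpace ℝ (Fin d))) (σ α g ν : ℝ) (θ : Fin d → ℝ)
    (x : Fin n → EuclideanSpace ℝ (Fin d)) (y : Fin n → ℝ) (z : EuclideanSpace ℝ (Fin d)) : ℝ :=
  ν ^ g * postStd σ α θ x z ^ g *
    tau g ((maxPostMean X σ α θ x y - postMean σ α θ x y z) / postStd σ α θ x z / ν)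

/-- The maximum information gain `γ^θ_{t,α}`: the maximum of `½ log det(I + α σ⁻² K_A^θ)` over
choices `A` of `t` points of `X` (repetitions are allowed). -/
def infoGain {d : ℕ} (X : Set (EuclideanSpace ℝ (Fin d))) (σ α : ℝ) (θ : Fin d → ℝ) (t : ℕ) : ℝ :=
  ⨆ A : Fin t → X, 1 / 2 * Real.log
    (1 + (α / σ ^ 2) • kernelMatrix θ (fun i => (A i : EuclideanSpace ℝ (Fin d)))).det

/-- `m^θ_{α,t} = √α (√γ^θ_{t-1,α} + √log(2 t² π² / (3δ)))`, used for `t ≥ 1` only. -/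
def mScale {d : ℕ} (X : Set (EuclideanSpace ℝ (Fin d))) (σ α δ : ℝ) (θ : Fin d → ℝ) (t : ℕ) : ℝ :=
  √α * (√(infoGain X σ α θ (t - 1)) + √(Real.log (2 * (t : ℝ) ^ 2 * Real.pi ^ 2 / (3 * δ))))

/-- The constant `C_(g) = 2^{g/2} Γ((g+1)/2) / (2 √π)`. -/
def gConst (g : ℝ) : ℝ :=
  (2 : ℝ) ^ (g / 2) * Real.Gamma ((g + 1) / 2) / (2 * √Real.pi)

/-- The ratio `σ² / (α (T - 1) + σ²)`, used for `T ≥ 1` only. -/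
def varRatio (σ α : ℝ) (T : ℕ) : ℝ :=
  σ ^ 2 / (α * ((T : ℝ) - 1) + σ ^ 2)

/-- `η_{α,g,T} = C'_g m^g (σ² / (α (T - 1) + σ²))^{(g-1)/2}`. -/
def etaTerm (Cg' m σ α g : ℝ) (T : ℕ) : ℝ :=
  Cg' * m ^ g * varRatio σ α T ^ ((g - 1) / 2)

/-- `β_{T,α,g} = √(2 C₂) ‖f‖ + [2√2 + C₁ τ_g⁻¹(C_(g) (σ²/(α(T-1)+σ²))^{g/2})] m + η_{α,g,T}`. -/
def betaTerm (Cg' C₁ C₂ normf m σ α g : ℝ) (T : ℕ) : ℝ :=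
  √(2 * C₂) * normf
    + (2 * √2 + C₁ * tauInv g (gConst g * varRatio σ α T ^ (g / 2))) * m
    + etaTerm Cg' m σ α g T

/-- The points `x_1, …, x_t` queried up to time `t`, on the outcome `ω`. -/
def queries {d : ℕ} {X : Set (EuclideanSpace ℝ (Fin d))} {Ω : Type*}
    (x : ℕ → Ω → X) (t : ℕ) (ω : Ω) : Fin t → EuclideanSpace ℝ (Fin d) :=
  fun i => (x (i + 1) ω : EuclideanSpace ℝ (Fin d))

/-- The responses `y_s = f(x_s) + ε_s`, `s = 1, …, t`, on the outcome `ω`. -/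
def responses {d : ℕ} {X : Set (EuclideanSpace ℝ (Fin d))} {Ω : Type*}
    (f : X → ℝ) (x : ℕ → Ω → X) (ε : ℕ → Ω → ℝ) (t : ℕ) (ω : Ω) : Fin t → ℝ :=
  fun i => f (x (i + 1) ω) + ε (i + 1) ω

/-- A run of tempered `g`-EI Bayesian optimization of `f` on the domain `X`: in the rounds
`t = 1, 2, …` the length-scales `θ_t ∈ [θL, θU]`, the exploration parameter `ν_t` (of the same order
as `m_{α,t}^{θ_t}`) and the query point `x_t` are chosen from the past `ℱ_{t-1}`, where `x_t`
maximizes the rescaled acquisition function that is computed from the data of the first `t - 1`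
rounds; then `f(x_t)` is observed with a fresh noise `ε_t ∼ N(0, σ²)`. -/
structure IsRun {d : ℕ} {X : Set (EuclideanSpace ℝ (Fin d))} {Ω : Type*} {mΩ : MeasurableSpace Ω}
    (P : Measure Ω) (σ α g δ C₁ C₀ : ℝ) (θL θU : Fin d → ℝ) (f : X → ℝ)
    (ℱ : Filtration ℕ mΩ) (ε : ℕ → Ω → ℝ) (x : ℕ → Ω → X) (θ : ℕ → Ω → Fin d → ℝ)
    (ν : ℕ → Ω → ℝ) : Prop where
  noise_adapted : ∀ t, 1 ≤ t → Measurable[ℱ t] (ε t)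
  noise_law : ∀ t, 1 ≤ t → HasLaw (ε t) (gaussianReal 0 (σ ^ 2).toNNReal) P
  noise_indep : ∀ t, 1 ≤ t → Indep (ℱ (t - 1)) (MeasurableSpace.comap (ε t) inferInstance) P
  theta_predictable : ∀ t, 1 ≤ t → Measurable[ℱ (t - 1)] (θ t)
  theta_mem : ∀ t, 1 ≤ t → ∀ ω i, θL i ≤ θ t ω i ∧ θ t ω i ≤ θU i
  nu_predictable : ∀ t, 1 ≤ t → Measurable[ℱ (t - 1)] (ν t)
  nu_pos : ∀ t, 1 ≤ t → ∀ ω, 0 < ν t ω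
  nu_lower : ∀ t, 1 ≤ t → ∀ ω, |mScale X σ α δ (θ t ω) t / ν t ω| ≤ C₁
  nu_upper : ∀ t, 1 ≤ t → ∀ ω, ν t ω ≤ C₀ * mScale X σ α δ (θ t ω) t
  query_predictable : ∀ t, 1 ≤ t → Measurable[ℱ (t - 1)] (x t)
  query_argmax : ∀ t, 1 ≤ t → ∀ ω, ∀ z : X,
    acquisition X σ α g (ν t ω) (θ t ω) (queries x (t - 1) ω) (responses f x ε (t - 1) ω) z ≤
      acquisition X σ α g (ν t ω) (θ t ω) (queries x (t - 1) ω) (responses f x ε (t - 1) ω) (x t ω)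

/-- The cumulative regret `R_T = ∑_{t=1}^T (f(x⋆) - f(x_t))`. -/
def cumRegret {d : ℕ} {X : Set (EuclideanSpace ℝ (Fin d))} {Ω : Type*}
    (f : X → ℝ) (xstar : X) (x : ℕ → Ω → X) (T : ℕ) (ω : Ω) : ℝ :=
  ∑ t ∈ Finset.Icc 1 T, (f xstar - f (x t ω))

end TemperedBO

end

open MeasureTheory ProbabilityTheory
open scoped Matrix

noncomputable section

/-! The case `g = 0` is deterministic. There `etaTerm` with `Cg' = 1` equals √((α(T-1)+σ²)/σ²), of
order √T, and the information gain is bounded below for T ≥ 1. The claimed bound is therefore at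
least a constant times T, while the regret is at most 2BT because |f| ≤ ‖f‖.

For `g > 0` the first ingredient is a confidence bound |f - μ| ≤ K · `mScale` · `postStd`, uniform
in rounds, points and length-scales. The posterior mean splits into a part linear in the values of f
and a part linear in the noise. The first part deviates from f(z) by the inner product of f with k_z
- ∑ wᵢ k_{xᵢ} in the RKHS of θU. Its norm there is compared with the norm for the current θ by
`gram_quadForm_le`: Gaussian spectral densities for larger length-scales are dominated by those for
smaller ones, up to the product of the ratios. For the noise part, the likelihood ratio of N(0, σ²I
+ αK) against N(0, σ²I) has expectation one even along adaptively chosen points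
(`lintegral_likRatio`). Markov's inequality then bounds `ridgeGain`, hence the noise part
(`postMean_sq_le`). Since θ_t may depend on the data, a union bound runs over a net of length-scales
that is refined with the round, and `ridgeGain_le_mul` and `log_gainDet_le_add` pass from the net to
θ_t.

The second ingredient, `instant_regret_le`, uses the maximality of x_t twice. Comparison with a
maximizer of the posterior mean bounds μ⁺ - μ(x_t) through τ_g⁻¹. Comparison with x⋆ shows that
either σ(x⋆) is at most a constant times σ(x_t), or x⋆ lies so far below μ⁺ that f(x⋆) ≤ μ⁺. The
constant involves a power 1/g, which is why `g = 0` is separate.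

Finally σ at θ_t is at most σ at θL by the Schur product theorem (`postCov_le_postCov`), and
Cauchy–Schwarz with the chain rule for log det sums the deviations. -/

namespace TemperedBO

/-! ### Gaussian spectral representation of the kernel -/

/-- The product Gaussian density with variances `c`. -/
def gaussDensity {d : ℕ} (c : Fin d → NNReal) (ω : Fin d → ℝ) : ℝ :=
  ∏ i, gaussianPDFReal 0 (c i) (ω i)

lemma gaussDensity_nonneg {d : ℕ} (c : Fin d → NNReal) (ω : Fin d → ℝ) :
    0 ≤ gaussDensity c ω :=
  Finset.prod_nonneg fun _ _ => gaussianPDFReal_nonneg _ _ _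

lemma integrable_gaussDensity {d : ℕ} (c : Fin d → NNReal) : Integrable (gaussDensity c) :=
  Integrable.fintype_prod fun i => integrable_gaussianPDFReal 0 (c i)

lemma integral_gaussianPDFReal_mul_exp (c : NNReal) (hc : c ≠ 0) (u : ℝ) :
    ∫ w : ℝ, (gaussianPDFReal 0 c w : ℂ) * Complex.exp (w * u * Complex.I)
      = Complex.exp (-(c * u ^ 2 / 2)) := by
  have h := charFun_gaussianReal (μ := 0) (v := c) u
  rw [charFun_apply_real, integral_gaussianReal_eq_integral_smul hc] at h
  simp only [Complex.real_smul] at h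
  rw [show (-(c * u ^ 2 / 2) : ℂ) = u * (0 : ℝ) * Complex.I - c * u ^ 2 / 2 by simp, ← h]
  congr 1; ext w; ring_nf

/-- The characteristic function of a product Gaussian. -/
lemma integral_gaussDensity_mul_cos {d : ℕ} (c : Fin d → NNReal) (hc : ∀ i, c i ≠ 0)
    (u : Fin d → ℝ) :
    ∫ ω : Fin d → ℝ, gaussDensity c ω * Real.cos (∑ i, ω i * u i)
      = Real.exp (-(1 / 2) * ∑ i, (c i : ℝ) * u i ^ 2) := by
  have h := integral_fintype_prod_volume_eq_prod (𝕜 := ℂ)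
    (fun (i : Fin d) (w : ℝ) =>
      (gaussianPDFReal 0 (c i) w : ℂ) * Complex.exp (w * u i * Complex.I))
  have hf : ∀ ω : Fin d → ℝ, ∏ i, ((gaussianPDFReal 0 (c i) (ω i) : ℂ) *
      Complex.exp (ω i * u i * Complex.I)) =
      (gaussDensity c ω : ℂ) * Complex.exp ((∑ i, ω i * u i : ℝ) * Complex.I) := by
    intro ω
    rw [Finset.prod_mul_distrib, ← Complex.exp_sum, gaussDensity]
    push_cast
    rw [Finset.sum_mul]
  simp_rw [hf, fun i => integral_gaussianPDFReal_mul_exp (c i) (hc i) (u i)] at h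
  have hint : Integrable (fun ω : Fin d → ℝ =>
      (gaussDensity c ω : ℂ) * Complex.exp ((∑ i, ω i * u i : ℝ) * Complex.I)) := by
    have hi : Integrable fun ω : Fin d → ℝ => (gaussDensity c ω : ℂ) :=
      (integrable_gaussDensity c).ofReal
    refine hi.mono ?_ ?_
    · refine hi.aestronglyMeasurable.mul ?_
      exact (by fun_prop : Continuous fun ω : Fin d → ℝ =>
        Complex.exp ((∑ i, ω i * u i : ℝ) * Complex.I)).aestronglyMeasurable
    · filter_upwards with ω
      rw [norm_mul, Complex.norm_exp_ofReal_mul_I, mul_one]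
  have h2 := congrArg Complex.re h
  rw [← RCLike.re_eq_complex_re, ← integral_re hint] at h2
  have h3 : ∀ ω : Fin d → ℝ, RCLike.re ((gaussDensity c ω : ℂ) *
      Complex.exp ((∑ i, ω i * u i : ℝ) * Complex.I)) =
      gaussDensity c ω * Real.cos (∑ i, ω i * u i) := by
    intro ω
    rw [RCLike.re_eq_complex_re, Complex.re_ofReal_mul, Complex.exp_ofReal_mul_I_re]
  simp_rw [h3] at h2
  rw [h2, ← Complex.exp_sum, RCLike.re_eq_complex_re,
    show (∑ i, -((c i : ℂ) * (u i : ℂ) ^ 2 / 2)) =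
      ((-(1 / 2) * ∑ i, (c i : ℝ) * u i ^ 2 : ℝ) : ℂ) by
      push_cast; rw [Finset.mul_sum]; congr 1; ext i; ring_nf,
    Complex.exp_ofReal_re]

lemma integrable_gaussDensity_mul_cos {d : ℕ} (c : Fin d → NNReal) (u : Fin d → ℝ) :
    Integrable fun ω : Fin d → ℝ => gaussDensity c ω * Real.cos (∑ i, ω i * u i) := by
  refine (integrable_gaussDensity c).mono ?_ ?_
  · exact (integrable_gaussDensity c).aestronglyMeasurable.mul
      (by fun_prop : Continuous fun ω : Fin d → ℝ =>
        Real.cos (∑ i, ω i * u i)).aestronglyMeasurable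
  · filter_upwards with ω
    rw [norm_mul]
    exact mul_le_of_le_one_right (norm_nonneg _) (Real.abs_cos_le_one _)

/-- The quadratic form of a stationary kernel as an integral of squares. -/
lemma quadForm_eq_integral {d : ℕ} {ι : Type*} [Fintype ι] (c : Fin d → NNReal)
    (hc : ∀ i, c i ≠ 0) (u : ι → Fin d → ℝ) (v : ι → ℝ) :
    ∑ i, ∑ j, v i * v j * Real.exp (-(1 / 2) * ∑ k, (c k : ℝ) * (u i k - u j k) ^ 2) =
      ∫ ω : Fin d → ℝ, gaussDensity c ω *
        ((∑ i, v i * Real.cos (∑ k, ω k * u i k)) ^ 2 +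
          (∑ i, v i * Real.sin (∑ k, ω k * u i k)) ^ 2) := by
  -- By cos(a - b) = cos a cos b + sin a sin b, the double sum of cosines of differences is a sum of
  -- two squares.
  have h : ∀ ω : Fin d → ℝ, gaussDensity c ω *
        ((∑ i, v i * Real.cos (∑ k, ω k * u i k)) ^ 2 +
          (∑ i, v i * Real.sin (∑ k, ω k * u i k)) ^ 2) =
      ∑ i, ∑ j, v i * v j * (gaussDensity c ω * Real.cos (∑ k, ω k * (u i k - u j k))) := by
    intro ω
    rw [sq, sq, Finset.sum_mul_sum, Finset.sum_mul_sum, ← Finset.sum_add_distrib, Finset.mul_sum]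
    refine Finset.sum_congr rfl fun i _ => ?_
    rw [← Finset.sum_add_distrib, Finset.mul_sum]
    refine Finset.sum_congr rfl fun j _ => ?_
    simp_rw [mul_sub]
    rw [Finset.sum_sub_distrib, Real.cos_sub]
    ring
  simp_rw [h]
  rw [integral_finsetSum _ fun i _ => integrable_finsetSum _ fun j _ =>
    (integrable_gaussDensity_mul_cos c _).const_mul _]
  refine Finset.sum_congr rfl fun i _ => ?_
  rw [integral_finsetSum _ fun j _ => (integrable_gaussDensity_mul_cos c _).const_mul _]
  refine Finset.sum_congr rfl fun j _ => ?_
  rw [integral_const_mul, integral_gaussDensity_mul_cos c hc]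

lemma integrable_gaussDensity_mul_sq {d : ℕ} {ι : Type*} [Fintype ι] (c : Fin d → NNReal)
    (u : ι → Fin d → ℝ) (v : ι → ℝ) :
    Integrable fun ω : Fin d → ℝ => gaussDensity c ω *
        ((∑ i, v i * Real.cos (∑ k, ω k * u i k)) ^ 2 +
          (∑ i, v i * Real.sin (∑ k, ω k * u i k)) ^ 2) := by
  refine ((integrable_gaussDensity c).mul_const ((∑ i, |v i|) ^ 2 + (∑ i, |v i|) ^ 2)).mono ?_ ?_
  · exact (integrable_gaussDensity c).aestronglyMeasurable.mul
      (by fun_prop : Continuous fun ω : Fin d → ℝ =>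
        ((∑ i, v i * Real.cos (∑ k, ω k * u i k)) ^ 2 +
          (∑ i, v i * Real.sin (∑ k, ω k * u i k)) ^ 2)).aestronglyMeasurable
  · filter_upwards with ω
    rw [norm_mul, norm_mul]
    refine mul_le_mul_of_nonneg_left ?_ (norm_nonneg _)
    have key : ∀ a : ι → ℝ, (∀ i, |a i| ≤ 1) → (∑ i, v i * a i) ^ 2 ≤ (∑ i, |v i|) ^ 2 := by
      intro a ha
      refine sq_le_sq' ?_ ?_
      · refine neg_le_of_abs_le ((Finset.abs_sum_le_sum_abs _ _).trans ?_)
        refine Finset.sum_le_sum fun i _ => ?_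
        rw [abs_mul]; exact mul_le_of_le_one_right (abs_nonneg _) (ha i)
      · refine le_of_abs_le ((Finset.abs_sum_le_sum_abs _ _).trans ?_)
        refine Finset.sum_le_sum fun i _ => ?_
        rw [abs_mul]; exact mul_le_of_le_one_right (abs_nonneg _) (ha i)
    rw [Real.norm_of_nonneg (by positivity), Real.norm_of_nonneg (by positivity)]
    exact add_le_add (key _ fun i => Real.abs_cos_le_one _) (key _ fun i => Real.abs_sin_le_one _)

/-- The wider Gaussian has the larger exponential factor, so only the ratio √(b/a) of the
normalising constants is lost. -/
lemma gaussianPDFReal_le_mul {a b : NNReal} (ha : a ≠ 0) (hab : a ≤ b) (w : ℝ) :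
    gaussianPDFReal 0 a w ≤ √(b / a : ℝ) * gaussianPDFReal 0 b w := by
  have ha' : (0 : ℝ) < a := by positivity
  have hab' : (a : ℝ) ≤ b := by exact_mod_cast hab
  have hb' : (0 : ℝ) < b := ha'.trans_le hab'
  rw [gaussianPDFReal, gaussianPDFReal, ← mul_assoc]
  have h1 : √(b / a : ℝ) * (√(2 * Real.pi * b))⁻¹ = (√(2 * Real.pi * a))⁻¹ := by
    rw [← Real.sqrt_inv, ← Real.sqrt_inv, ← Real.sqrt_mul (by positivity)]
    congr 1; field_simp
  rw [h1]
  refine mul_le_mul_of_nonneg_left (Real.exp_le_exp.2 ?_) (by positivity)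
  rw [neg_div, neg_div, neg_le_neg_iff]
  exact div_le_div_of_nonneg_left (sq_nonneg _) (by positivity) (by linarith)

/-! ### Gram matrices and comparison of length-scales -/

/-- The matrix `[k^θ(x_i, x_j)]` of a family of points. -/
def gram {d : ℕ} {ι : Type*} (θ : Fin d → ℝ) (x : ι → EuclideanSpace ℝ (Fin d)) : Matrix ι ι ℝ :=
  Matrix.of fun i j => seKernel θ (x i) (x j)

lemma seKernel_comm {d : ℕ} (θ : Fin d → ℝ) (x y : EuclideanSpace ℝ (Fin d)) :
    seKernel θ x y = seKernel θ y x := by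
  simp_rw [seKernel, fun i => sub_sq_comm (x i) (y i)]

@[simp] lemma seKernel_self {d : ℕ} (θ : Fin d → ℝ) (x : EuclideanSpace ℝ (Fin d)) :
    seKernel θ x x = 1 := by
  simp [seKernel]

lemma seKernel_pos {d : ℕ} (θ : Fin d → ℝ) (x y : EuclideanSpace ℝ (Fin d)) :
    0 < seKernel θ x y := Real.exp_pos _

lemma seKernel_le_one {d : ℕ} (θ : Fin d → ℝ) (x y : EuclideanSpace ℝ (Fin d)) :
    seKernel θ x y ≤ 1 := by
  rw [seKernel, Real.exp_le_one_iff]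
  have : 0 ≤ ∑ i, (x i - y i) ^ 2 / (θ i) ^ 2 := Finset.sum_nonneg fun _ _ => by positivity
  linarith

lemma isHermitian_gram {d : ℕ} {ι : Type*} (θ : Fin d → ℝ)
    (x : ι → EuclideanSpace ℝ (Fin d)) : (gram θ x).IsHermitian := by
  ext i j
  simp [gram, seKernel_comm θ (x i) (x j)]

lemma dotProduct_gram_mulVec {d : ℕ} {ι : Type*} [Fintype ι] (θ : Fin d → ℝ)
    (x : ι → EuclideanSpace ℝ (Fin d)) (v : ι → ℝ) :
    v ⬝ᵥ gram θ x *ᵥ v = ∑ i, ∑ j, v i * v j * seKernel θ (x i) (x j) := by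
  simp only [dotProduct, Matrix.mulVec, gram, Matrix.of_apply, Finset.mul_sum]
  refine Finset.sum_congr rfl fun i _ => Finset.sum_congr rfl fun j _ => ?_
  ring

/-- Dividing the coordinates by θ reduces to unit variances. No positivity of θ is needed: where `θ
k = 0`, division by zero makes both sides ignore the coordinate. -/
lemma posSemidef_gram {d : ℕ} {ι : Type*} [Fintype ι] (θ : Fin d → ℝ)
    (x : ι → EuclideanSpace ℝ (Fin d)) : (gram θ x).PosSemidef := by
  refine Matrix.PosSemidef.of_dotProduct_mulVec_nonneg (isHermitian_gram θ x) fun v => ?_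
  rw [star_trivial, dotProduct_gram_mulVec]
  have h := quadForm_eq_integral (fun _ : Fin d => (1 : NNReal)) (fun _ => one_ne_zero)
    (fun i k => x i k / θ k) v
  have h2 : ∀ i j, seKernel θ (x i) (x j) = Real.exp (-(1 / 2) *
      ∑ k, ((1 : NNReal) : ℝ) * (x i k / θ k - x j k / θ k) ^ 2) := by
    intro i j
    simp only [seKernel, NNReal.coe_one, one_mul, ← sub_div, div_pow]
  simp_rw [h2, h]
  exact integral_nonneg fun ω => mul_nonneg (gaussDensity_nonneg _ _) (by positivity)

/-- A kernel with larger length-scales is dominated by one with smaller length-scales. -/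
lemma gram_quadForm_le {d : ℕ} {ι : Type*} [Fintype ι] {θ θ' : Fin d → ℝ}
    (hθ' : ∀ i, 0 < θ' i) (h : ∀ i, θ' i ≤ θ i)
    (x : ι → EuclideanSpace ℝ (Fin d)) (v : ι → ℝ) :
    v ⬝ᵥ gram θ x *ᵥ v ≤ (∏ i, θ i / θ' i) * (v ⬝ᵥ gram θ' x *ᵥ v) := by
  have hθ : ∀ i, 0 < θ i := fun i => (hθ' i).trans_le (h i)
  -- The spectral measure for length-scales η is Gaussian with variances η⁻², so larger
  -- length-scales mean smaller variances.
  have key : ∀ {η : Fin d → ℝ}, (∀ i, 0 < η i) → v ⬝ᵥ gram η x *ᵥ v =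
      ∫ ω : Fin d → ℝ, gaussDensity (fun i => ((η i ^ 2)⁻¹).toNNReal) ω *
        ((∑ i, v i * Real.cos (∑ k, ω k * x i k)) ^ 2 +
          (∑ i, v i * Real.sin (∑ k, ω k * x i k)) ^ 2) := by
    intro η hη
    rw [← quadForm_eq_integral _ (fun i => ?_), dotProduct_gram_mulVec]
    · refine Finset.sum_congr rfl fun i _ => Finset.sum_congr rfl fun j _ => ?_
      rw [seKernel]
      congr 4; ext k
      rw [Real.coe_toNNReal _ (by positivity), div_eq_inv_mul]
    · have := hη i
      simp only [ne_eq, Real.toNNReal_eq_zero, not_le]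
      positivity
  rw [key hθ, key hθ', ← integral_const_mul]
  refine integral_mono (integrable_gaussDensity_mul_sq _ _ _)
    ((integrable_gaussDensity_mul_sq _ _ _).const_mul _) fun ω => ?_
  simp only
  rw [← mul_assoc]
  refine mul_le_mul_of_nonneg_right ?_ (by positivity)
  rw [gaussDensity, gaussDensity, ← Finset.prod_mul_distrib]
  refine Finset.prod_le_prod (fun _ _ => gaussianPDFReal_nonneg _ _ _) fun i _ => ?_
  have h1 := hθ i
  have h2 := hθ' i
  refine (gaussianPDFReal_le_mul (b := ((θ' i ^ 2)⁻¹).toNNReal) ?_ ?_ _).trans_eq ?_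
  · simp only [ne_eq, Real.toNNReal_eq_zero, not_le]
    positivity
  · refine Real.toNNReal_le_toNNReal (inv_anti₀ (by positivity) ?_)
    have := h i
    gcongr
  · congr 1
    rw [Real.coe_toNNReal _ (by positivity), Real.coe_toNNReal _ (by positivity),
      inv_div_inv, ← div_pow, Real.sqrt_sq (by positivity)]

lemma abs_exp_neg_sub_exp_neg_le {a b : ℝ} (ha : 0 ≤ a) (hb : 0 ≤ b) :
    |Real.exp (-a) - Real.exp (-b)| ≤ |a - b| := by
  wlog hab : a ≤ b generalizing a b
  · rw [abs_sub_comm, abs_sub_comm a]; exact this hb ha (le_of_not_ge hab)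
  rw [abs_of_nonneg (sub_nonneg.2 (Real.exp_le_exp.2 (by linarith))), abs_of_nonpos (by linarith)]
  have h1 : Real.exp (-b) = Real.exp (-a) * Real.exp (-(b - a)) := by
    rw [← Real.exp_add]; ring_nf
  have h2 := Real.add_one_le_exp (-(b - a))
  have h3 : Real.exp (-a) ≤ 1 := Real.exp_le_one_iff.2 (by linarith)
  have h4 := Real.exp_pos (-a)
  rw [h1]
  nlinarith

/-- The kernel is Lipschitz in the precisions θ⁻² because exp(-·) is 1-Lipschitz on [0, ∞); this is
why the net below is equispaced in precisions. -/
lemma abs_seKernel_sub_le {d : ℕ} (θ θ' : Fin d → ℝ) (x y : EuclideanSpace ℝ (Fin d)) :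
    |seKernel θ x y - seKernel θ' x y| ≤
      1 / 2 * ∑ i, (x i - y i) ^ 2 * |(θ i ^ 2)⁻¹ - (θ' i ^ 2)⁻¹| := by
  rw [seKernel, seKernel, neg_mul, neg_mul]
  refine (abs_exp_neg_sub_exp_neg_le ?_ ?_).trans ?_
  · exact mul_nonneg (by norm_num) (Finset.sum_nonneg fun _ _ => by positivity)
  · exact mul_nonneg (by norm_num) (Finset.sum_nonneg fun _ _ => by positivity)
  rw [← mul_sub, abs_mul, abs_of_pos (by norm_num : (0 : ℝ) < 1 / 2), ← Finset.sum_sub_distrib]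
  refine mul_le_mul_of_nonneg_left ((Finset.abs_sum_le_sum_abs _ _).trans_eq ?_) (by norm_num)
  refine Finset.sum_congr rfl fun i _ => ?_
  rw [div_eq_mul_inv, div_eq_mul_inv, ← mul_sub, abs_mul, abs_of_nonneg (sq_nonneg _)]

/-- Shrinking the length-scales multiplies the kernel by another squared exponential kernel. -/
lemma exists_seKernel_eq_mul {d : ℕ} {θ θ' : Fin d → ℝ} (hθ' : ∀ i, 0 < θ' i)
    (h : ∀ i, θ' i ≤ θ i) :
    ∃ η : Fin d → ℝ, ∀ x y, seKernel θ' x y = seKernel θ x y * seKernel η x y := by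
  -- Precisions add under multiplication of kernels. If `θ' i = θ i`, this entry is 0, and division
  -- by zero removes the coordinate, as it should.
  refine ⟨fun i => (√((θ' i ^ 2)⁻¹ - (θ i ^ 2)⁻¹))⁻¹, fun x y => ?_⟩
  rw [seKernel, seKernel, seKernel, ← Real.exp_add, ← mul_add, ← Finset.sum_add_distrib]
  congr 2
  refine Finset.sum_congr rfl fun i _ => ?_
  have h1 := hθ' i
  have h2 : (θ i ^ 2)⁻¹ ≤ (θ' i ^ 2)⁻¹ := by
    refine inv_anti₀ (by positivity) ?_
    have := h i
    gcongr
  rw [inv_pow, Real.sq_sqrt (by linarith), div_inv_eq_mul, div_eq_mul_inv, div_eq_mul_inv]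
  ring

lemma continuous_seKernel {d : ℕ} {Y : Type*} [TopologicalSpace Y] (θ : Fin d → ℝ)
    {u v : Y → EuclideanSpace ℝ (Fin d)} (hu : Continuous u) (hv : Continuous v) :
    Continuous fun y => seKernel θ (u y) (v y) := by
  unfold seKernel
  fun_prop

/-! ### Posterior variance as a minimal regularised residual -/

/-- The regularised kernel matrix `K + l I`. -/
def regGram {d n : ℕ} (l : ℝ) (θ : Fin d → ℝ) (x : Fin n → EuclideanSpace ℝ (Fin d)) :
    Matrix (Fin n) (Fin n) ℝ :=
  kernelMatrix θ x + l • (1 : Matrix (Fin n) (Fin n) ℝ)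

lemma temperedInv_eq {d n : ℕ} (σ α : ℝ) (θ : Fin d → ℝ) (x : Fin n → EuclideanSpace ℝ (Fin d)) :
    temperedInv σ α θ x = (regGram (σ ^ 2 / α) θ x)⁻¹ := rfl

lemma posSemidef_kernelMatrix {d n : ℕ} (θ : Fin d → ℝ) (x : Fin n → EuclideanSpace ℝ (Fin d)) :
    (kernelMatrix θ x).PosSemidef := posSemidef_gram θ x

lemma posDef_regGram {d n : ℕ} {l : ℝ} (hl : 0 < l) (θ : Fin d → ℝ)
    (x : Fin n → EuclideanSpace ℝ (Fin d)) : (regGram l θ x).PosDef :=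
  (Matrix.PosDef.one.smul hl).posSemidef_add (posSemidef_kernelMatrix θ x)

lemma regGram_mulVec {d n : ℕ} (l : ℝ) (θ : Fin d → ℝ) (x : Fin n → EuclideanSpace ℝ (Fin d))
    (v : Fin n → ℝ) : regGram l θ x *ᵥ v = kernelMatrix θ x *ᵥ v + l • v := by
  rw [regGram, Matrix.add_mulVec, Matrix.smul_mulVec, Matrix.one_mulVec]

section Posterior

variable {d n : ℕ} {σ α : ℝ} (θ : Fin d → ℝ) (x : Fin n → EuclideanSpace ℝ (Fin d))

lemma regGram_mulVec_temperedInv (hl : 0 < σ ^ 2 / α) (y : Fin n → ℝ) :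
    regGram (σ ^ 2 / α) θ x *ᵥ (temperedInv σ α θ x *ᵥ y) = y := by
  rw [temperedInv_eq, Matrix.mulVec_mulVec, Matrix.mul_nonsing_inv _
    ((Matrix.isUnit_iff_isUnit_det _).1 (posDef_regGram hl θ x).isUnit), Matrix.one_mulVec]

lemma temperedInv_mulVec_eq (hl : 0 < σ ^ 2 / α) {u y : Fin n → ℝ}
    (h : regGram (σ ^ 2 / α) θ x *ᵥ u = y) : temperedInv σ α θ x *ᵥ y = u := by
  rw [temperedInv_eq, ← h, Matrix.mulVec_mulVec, Matrix.nonsing_inv_mul _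
    ((Matrix.isUnit_iff_isUnit_det _).1 (posDef_regGram hl θ x).isUnit), Matrix.one_mulVec]

lemma dotProduct_kernelMatrix_mulVec_comm (u v : Fin n → ℝ) :
    u ⬝ᵥ kernelMatrix θ x *ᵥ v = v ⬝ᵥ kernelMatrix θ x *ᵥ u := by
  have h : (kernelMatrix θ x)ᵀ = kernelMatrix θ x := by
    have := (posSemidef_kernelMatrix θ x).isHermitian
    rwa [Matrix.IsHermitian, Matrix.conjTranspose_eq_transpose_of_trivial] at this
  rw [Matrix.dotProduct_mulVec, ← Matrix.mulVec_transpose, h, dotProduct_comm]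

lemma dotProduct_regGram_mulVec_comm (l : ℝ) (u v : Fin n → ℝ) :
    u ⬝ᵥ regGram l θ x *ᵥ v = v ⬝ᵥ regGram l θ x *ᵥ u := by
  simp only [regGram_mulVec, dotProduct_add, dotProduct_smul]
  rw [dotProduct_kernelMatrix_mulVec_comm, dotProduct_comm u v]

lemma dotProduct_temperedInv_comm (hl : 0 < σ ^ 2 / α) (u v : Fin n → ℝ) :
    u ⬝ᵥ temperedInv σ α θ x *ᵥ v = v ⬝ᵥ temperedInv σ α θ x *ᵥ u := by
  conv_lhs => rw [← regGram_mulVec_temperedInv θ x hl u, dotProduct_comm,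
    dotProduct_regGram_mulVec_comm, regGram_mulVec_temperedInv θ x hl, dotProduct_comm]

/-- The squared RKHS distance from `k_z` to `∑ w_i k_{x_i}`. -/
def residual (z : EuclideanSpace ℝ (Fin d)) (w : Fin n → ℝ) : ℝ :=
  1 - 2 * (w ⬝ᵥ kernelVec θ x z) + w ⬝ᵥ kernelMatrix θ x *ᵥ w

variable (z : EuclideanSpace ℝ (Fin d))

/-- The points `x` with `z` appended. -/
def extend : Fin n ⊕ Fin 1 → EuclideanSpace ℝ (Fin d) := Sum.elim x fun _ => z

/-- The coefficients of `k_z - ∑ w_i k_{x_i}` in the kernels of the extended point set. -/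
def extendCoeff (w : Fin n → ℝ) : Fin n ⊕ Fin 1 → ℝ := Sum.elim (-w) fun _ => 1

lemma residual_eq_quadForm (w : Fin n → ℝ) :
    residual θ x z w = extendCoeff w ⬝ᵥ gram θ (extend x z) *ᵥ extendCoeff w := by
  rw [dotProduct_gram_mulVec]
  simp only [residual, Fintype.sum_sum_type, extend, extendCoeff, Sum.elim_inl, Sum.elim_inr,
    Finset.univ_unique, Finset.sum_singleton, Pi.neg_apply, dotProduct, Matrix.mulVec,
    kernelVec, kernelMatrix, Matrix.of_apply, seKernel_self, Finset.mul_sum,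
    Finset.sum_add_distrib, seKernel_comm θ z]
  have h1 : ∑ i, ∑ j, -w i * -w j * seKernel θ (x i) (x j) =
      ∑ i, ∑ j, w i * (seKernel θ (x i) (x j) * w j) :=
    Finset.sum_congr rfl fun i _ => Finset.sum_congr rfl fun j _ => by ring
  have h2 : ∀ c : ℝ, ∑ i, c * (w i * seKernel θ (x i) z) = c * ∑ i, w i * seKernel θ (x i) z :=
    fun c => (Finset.mul_sum _ _ _).symm
  have h3 : ∑ i, -w i * 1 * seKernel θ (x i) z = (-1) * ∑ i, w i * seKernel θ (x i) z := by
    rw [← h2]; exact Finset.sum_congr rfl fun i _ => by ring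
  have h4 : ∑ i, 1 * -w i * seKernel θ (x i) z = (-1) * ∑ i, w i * seKernel θ (x i) z := by
    rw [← h2]; exact Finset.sum_congr rfl fun i _ => by ring
  rw [h1, h2, h3, h4]
  ring

lemma residual_nonneg (w : Fin n → ℝ) : 0 ≤ residual θ x z w := by
  rw [residual_eq_quadForm]
  simpa using (posSemidef_gram θ (extend x z)).dotProduct_mulVec_nonneg (extendCoeff w)

/-- The kernel column at `z`. -/
def kernelCol : Matrix (Fin n) (Fin 1) ℝ := Matrix.of fun i _ => kernelVec θ x z i

lemma kernelCol_inv_kernelCol :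
    (kernelCol θ x z)ᴴ * temperedInv σ α θ x * kernelCol θ x z =
      Matrix.of fun _ _ => kernelVec θ x z ⬝ᵥ (temperedInv σ α θ x *ᵥ kernelVec θ x z) := by
  ext i j
  rw [Matrix.mul_assoc]
  simp [kernelCol, Matrix.mul_apply, dotProduct, Matrix.mulVec]

/-- The extended regularised kernel matrix, with `s` subtracted from the last diagonal entry. -/
def bordered (l : ℝ) (s : ℝ) : Matrix (Fin n ⊕ Fin 1) (Fin n ⊕ Fin 1) ℝ :=
  Matrix.fromBlocks (regGram l θ x) (kernelCol θ x z) (kernelCol θ x z)ᴴ (Matrix.of fun _ _ => 1 - s)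

/-- The posterior variance is the Schur complement of the regularised block, so subtracting it from
the corner leaves Schur complement zero. -/
lemma posSemidef_bordered (hl : 0 < σ ^ 2 / α) :
    (bordered θ x z (σ ^ 2 / α) (postCov σ α θ x z z)).PosSemidef := by
  have hA := posDef_regGram hl θ x
  have : Invertible (regGram (σ ^ 2 / α) θ x) := hA.isUnit.invertible
  rw [bordered, Matrix.PosDef.fromBlocks₁₁ _ _ hA, ← temperedInv_eq, kernelCol_inv_kernelCol]
  convert Matrix.PosSemidef.zero
  ext i j
  simp [postCov]

lemma bordered_quadForm (l s : ℝ) (w : Fin n → ℝ) :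
    extendCoeff w ⬝ᵥ bordered θ x z l s *ᵥ extendCoeff w =
      residual θ x z w + l * (w ⬝ᵥ w) - s := by
  have h1 : (kernelCol θ x z)ᴴ *ᵥ w = fun _ => w ⬝ᵥ kernelVec θ x z := by
    ext i; simp [kernelCol, Matrix.mulVec, dotProduct, mul_comm]
  have h2 : kernelCol θ x z *ᵥ (fun _ => 1) = kernelVec θ x z := by
    ext i; simp [kernelCol, Matrix.mulVec, dotProduct]
  have h3 : (Matrix.of fun _ _ : Fin 1 => 1 - s) *ᵥ (fun _ => 1) = fun _ => 1 - s := by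
    ext i; simp [Matrix.mulVec, dotProduct]
  have h4 : ∀ c : ℝ, (fun _ : Fin 1 => (1 : ℝ)) ⬝ᵥ (fun _ => c) = c := by
    intro c; simp [dotProduct]
  rw [bordered, extendCoeff, Matrix.fromBlocks_mulVec, Sum.elim_comp_inl, Sum.elim_comp_inr, h2,
    Matrix.mulVec_neg, Matrix.mulVec_neg, h1, h3, sumElim_dotProduct_sumElim, regGram_mulVec, residual]
  simp only [dotProduct_add, neg_dotProduct, dotProduct_neg, dotProduct_smul, smul_eq_mul, h4]
  ring

/-- The nonnegative bordered form is evaluated at (-w, 1). Together with `postCov_eq` this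
characterises the posterior variance as the minimum over weights w, attained at `postWeights`. -/
lemma postCov_le (hl : 0 < σ ^ 2 / α) (w : Fin n → ℝ) :
    postCov σ α θ x z z ≤ residual θ x z w + σ ^ 2 / α * (w ⬝ᵥ w) := by
  have h := (posSemidef_bordered θ x z hl).dotProduct_mulVec_nonneg (extendCoeff w)
  rw [star_trivial, bordered_quadForm] at h
  linarith

/-- The weights of the posterior mean at `z`. -/
def postWeights (σ α : ℝ) : Fin n → ℝ := temperedInv σ α θ x *ᵥ kernelVec θ x z

lemma postCov_eq (hl : 0 < σ ^ 2 / α) :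
    postCov σ α θ x z z = residual θ x z (postWeights θ x z σ α) +
      σ ^ 2 / α * (postWeights θ x z σ α ⬝ᵥ postWeights θ x z σ α) := by
  have h := regGram_mulVec_temperedInv θ x hl (kernelVec θ x z)
  have h2 : postWeights θ x z σ α ⬝ᵥ kernelVec θ x z =
      postWeights θ x z σ α ⬝ᵥ (kernelMatrix θ x *ᵥ postWeights θ x z σ α) +
      σ ^ 2 / α * (postWeights θ x z σ α ⬝ᵥ postWeights θ x z σ α) := by
    conv_lhs => rw [← h, regGram_mulVec, dotProduct_add, dotProduct_smul]
    rfl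
  rw [postCov, residual, seKernel_self, ← postWeights, dotProduct_comm (kernelVec θ x z)]
  linarith

lemma postMean_eq (hl : 0 < σ ^ 2 / α) (y : Fin n → ℝ) :
    postMean σ α θ x y z = postWeights θ x z σ α ⬝ᵥ y := by
  rw [postMean, postWeights, dotProduct_temperedInv_comm θ x hl, dotProduct_comm]

lemma dotProduct_self_nonneg' {ι : Type*} [Fintype ι] (w : ι → ℝ) : 0 ≤ w ⬝ᵥ w :=
  Finset.sum_nonneg fun _ _ => mul_self_nonneg _

lemma residual_postWeights_le (hl : 0 < σ ^ 2 / α) :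
    residual θ x z (postWeights θ x z σ α) ≤ postCov σ α θ x z z := by
  rw [postCov_eq θ x z hl]
  have := mul_nonneg hl.le (dotProduct_self_nonneg' (postWeights θ x z σ α))
  linarith

lemma postWeights_sq_le (hl : 0 < σ ^ 2 / α) :
    σ ^ 2 / α * (postWeights θ x z σ α ⬝ᵥ postWeights θ x z σ α) ≤ postCov σ α θ x z z := by
  rw [postCov_eq θ x z hl]
  linarith [residual_nonneg θ x z (postWeights θ x z σ α)]

lemma postCov_nonneg (hl : 0 < σ ^ 2 / α) : 0 ≤ postCov σ α θ x z z :=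
  (residual_nonneg θ x z _).trans (residual_postWeights_le θ x z hl)

lemma postCov_le_one (hl : 0 < σ ^ 2 / α) : postCov σ α θ x z z ≤ 1 := by
  simpa [residual] using postCov_le θ x z hl 0

/-- The posterior variance decreases when the length-scales grow. -/
lemma postCov_le_postCov (hl : 0 < σ ^ 2 / α) {θ θ' : Fin d → ℝ} (hθ' : ∀ i, 0 < θ' i)
    (h : ∀ i, θ' i ≤ θ i) : postCov σ α θ x z z ≤ postCov σ α θ' x z z := by
  obtain ⟨η, hη⟩ := exists_seKernel_eq_mul hθ' h
  -- Schur product theorem. The factor has unit diagonal, so regularisation and corner entry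
  -- survive: the product is the bordered matrix of θ' with the posterior variance of θ still
  -- subtracted.
  have h1 := (posSemidef_bordered θ x z hl).hadamard (posSemidef_gram η (extend x z))
  have h2 : Matrix.hadamard (bordered θ x z (σ ^ 2 / α) (postCov σ α θ x z z))
      (gram η (extend x z)) = bordered θ' x z (σ ^ 2 / α) (postCov σ α θ x z z) := by
    ext i j
    rcases i with i | i <;> rcases j with j | j
    · simp only [Matrix.hadamard_apply, bordered, Matrix.fromBlocks_apply₁₁, gram, Matrix.of_apply,
        extend, Sum.elim_inl, regGram, kernelMatrix, Matrix.add_apply, hη, Matrix.smul_apply,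
        Matrix.one_apply, smul_eq_mul, add_mul]
      by_cases hij : i = j <;> simp [hij]
    · simp [bordered, gram, extend, kernelCol, kernelVec, hη]
    · simp [bordered, gram, extend, kernelCol, kernelVec, hη, seKernel_comm η z]
    · simp [bordered, gram, extend]
  rw [h2] at h1
  have h3 := h1.dotProduct_mulVec_nonneg (extendCoeff (postWeights θ' x z σ α))
  rw [star_trivial, bordered_quadForm, ← postCov_eq θ' x z hl] at h3
  linarith

/-- Posterior variances of uniformly close kernels are close. -/
lemma postCov_le_add (hl : 0 < σ ^ 2 / α) {θ θ' : Fin d → ℝ} {η : ℝ} (hη : 0 ≤ η)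
    (h : ∀ i j, |seKernel θ' (extend x z i) (extend x z j) -
      seKernel θ (extend x z i) (extend x z j)| ≤ η) :
    postCov σ α θ' x z z ≤ postCov σ α θ x z z + η * ((n + 1) * (1 + (σ ^ 2 / α)⁻¹)) := by
  -- The weights optimal for θ serve as trial weights for θ'.
  set w := postWeights θ x z σ α
  refine (postCov_le θ' x z hl w).trans ?_
  rw [postCov_eq θ x z hl]
  suffices residual θ' x z w ≤ residual θ x z w + η * ((n + 1) * (1 + (σ ^ 2 / α)⁻¹)) by linarith
  set v := extendCoeff w
  have h1 : residual θ' x z w - residual θ x z w ≤ η * (∑ i, |v i|) ^ 2 := by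
    rw [residual_eq_quadForm, residual_eq_quadForm, dotProduct_gram_mulVec, dotProduct_gram_mulVec,
      ← Finset.sum_sub_distrib, sq, Finset.sum_mul_sum, Finset.mul_sum]
    refine Finset.sum_le_sum fun i _ => ?_
    rw [← Finset.sum_sub_distrib, Finset.mul_sum]
    refine Finset.sum_le_sum fun j _ => ?_
    rw [← mul_sub]
    refine (le_abs_self _).trans ?_
    rw [abs_mul, abs_mul, mul_comm η]
    exact mul_le_mul_of_nonneg_left (h i j) (by positivity)
  have h2 : (∑ i, |v i|) ^ 2 ≤ (n + 1) * (1 + w ⬝ᵥ w) := by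
    refine (sq_sum_le_card_mul_sum_sq).trans_eq ?_
    simp [v, extendCoeff, dotProduct, sq, add_comm]
  have h3 : w ⬝ᵥ w ≤ (σ ^ 2 / α)⁻¹ := by
    rw [← mul_le_mul_iff_of_pos_left hl, mul_inv_cancel₀ hl.ne']
    exact (postWeights_sq_le θ x z hl).trans (postCov_le_one θ x z hl)
  have h4 : η * (∑ i, |v i|) ^ 2 ≤ η * ((n + 1) * (1 + (σ ^ 2 / α)⁻¹)) := by
    gcongr
    exact h2.trans (by gcongr)
  linarith

end Posterior

/-! ### Adding one point: determinants and ridge gain -/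

section Recursion

variable {d n : ℕ} {σ α : ℝ} (θ : Fin d → ℝ) (x : Fin (n + 1) → EuclideanSpace ℝ (Fin d))

/-- The first `n` points. -/
abbrev initPts : Fin n → EuclideanSpace ℝ (Fin d) := fun i => x i.castSucc

lemma det_regGram_succ (hl : 0 < σ ^ 2 / α) :
    (regGram (σ ^ 2 / α) θ x).det = (regGram (σ ^ 2 / α) θ (initPts x)).det *
      (σ ^ 2 / α + postCov σ α θ (initPts x) (x (Fin.last n)) (x (Fin.last n))) := by
  have hA := posDef_regGram hl θ (initPts x)
  have : Invertible (regGram (σ ^ 2 / α) θ (initPts x)) := hA.isUnit.invertible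
  have h : (regGram (σ ^ 2 / α) θ x).submatrix (finSumFinEquiv (m := n) (n := 1)) finSumFinEquiv =
      Matrix.fromBlocks (regGram (σ ^ 2 / α) θ (initPts x)) (kernelCol θ (initPts x) (x (Fin.last n)))
        (kernelCol θ (initPts x) (x (Fin.last n)))ᴴ (Matrix.of fun _ _ => 1 + σ ^ 2 / α) := by
    have hlast : ∀ i : Fin 1, Fin.natAdd n i = Fin.last n := by
      intro i; ext; simp
    have hcast : ∀ i : Fin n, Fin.castAdd 1 i = i.castSucc := fun _ => rfl
    have hne : ∀ i : Fin n, i.castSucc ≠ Fin.last n := Fin.castSucc_ne_last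
    ext i j
    rcases i with i | i <;> rcases j with j | j
    · simp [regGram, kernelMatrix, hcast, Matrix.one_apply]
    · simp [regGram, kernelMatrix, kernelCol, kernelVec, hlast, hcast, hne]
    · simp [regGram, kernelMatrix, kernelCol, kernelVec, hlast, hcast,
        (hne _).symm, seKernel_comm θ (x (Fin.last n))]
    · simp [regGram, kernelMatrix, hlast]
  rw [← Matrix.det_submatrix_equiv_self (finSumFinEquiv (m := n) (n := 1)), h,
    Matrix.det_fromBlocks₁₁, Matrix.invOf_eq_nonsing_inv, ← temperedInv_eq, kernelCol_inv_kernelCol]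
  congr 1
  rw [Matrix.det_fin_one]
  simp [postCov]
  ring

/-- The determinant `det (I + α σ⁻² K)`. -/
def gainDet {d n : ℕ} (σ α : ℝ) (θ : Fin d → ℝ) (x : Fin n → EuclideanSpace ℝ (Fin d)) : ℝ :=
  (1 + (α / σ ^ 2) • kernelMatrix θ x).det

lemma gainDet_eq {d n : ℕ} {σ α : ℝ} (hl : 0 < σ ^ 2 / α) (θ : Fin d → ℝ)
    (x : Fin n → EuclideanSpace ℝ (Fin d)) :
    gainDet σ α θ x = ((σ ^ 2 / α)⁻¹) ^ n * (regGram (σ ^ 2 / α) θ x).det := by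
  have h : (1 + (α / σ ^ 2) • kernelMatrix θ x) = (σ ^ 2 / α)⁻¹ • regGram (σ ^ 2 / α) θ x := by
    rw [regGram, smul_add, smul_smul, inv_mul_cancel₀ hl.ne', one_smul, inv_div, add_comm]
  rw [gainDet, h, Matrix.det_smul, Fintype.card_fin]

@[simp] lemma gainDet_zero {d : ℕ} {σ α : ℝ} (θ : Fin d → ℝ)
    (x : Fin 0 → EuclideanSpace ℝ (Fin d)) : gainDet σ α θ x = 1 := by
  simp [gainDet]

/-- The chain rule for information: each new point contributes ½ log(1 + s/l), with s its posterior
variance given the earlier points and l = σ²/α. -/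
lemma gainDet_succ (hl : 0 < σ ^ 2 / α) :
    gainDet σ α θ x = gainDet σ α θ (initPts x) *
      (1 + (σ ^ 2 / α)⁻¹ * postCov σ α θ (initPts x) (x (Fin.last n)) (x (Fin.last n))) := by
  rw [gainDet_eq hl, gainDet_eq hl, det_regGram_succ θ x hl, pow_succ]
  have h1 : (σ ^ 2 / α)⁻¹ * (σ ^ 2 / α) = 1 := inv_mul_cancel₀ hl.ne'
  linear_combination (((σ ^ 2 / α)⁻¹) ^ n * (regGram (σ ^ 2 / α) θ (initPts x)).det) * h1

lemma gainDet_pos {d n : ℕ} {σ α : ℝ} (hl : 0 < σ ^ 2 / α) (θ : Fin d → ℝ)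
    (x : Fin n → EuclideanSpace ℝ (Fin d)) : 0 < gainDet σ α θ x := by
  rw [gainDet_eq hl]
  exact mul_pos (by positivity) (posDef_regGram hl θ x).det_pos

/-- The quadratic form `yᵀ K (K + l I)⁻¹ y`, with `l = σ²/α`. -/
def ridgeGain {d n : ℕ} (σ α : ℝ) (θ : Fin d → ℝ) (x : Fin n → EuclideanSpace ℝ (Fin d))
    (y : Fin n → ℝ) : ℝ :=
  y ⬝ᵥ y - σ ^ 2 / α * (y ⬝ᵥ (temperedInv σ α θ x *ᵥ y))

lemma ridgeGain_nonneg {d n : ℕ} {σ α : ℝ} (hl : 0 < σ ^ 2 / α) (θ : Fin d → ℝ)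
    (x : Fin n → EuclideanSpace ℝ (Fin d)) (y : Fin n → ℝ) : 0 ≤ ridgeGain σ α θ x y := by
  set u := temperedInv σ α θ x *ᵥ y with hu
  have hy : y = kernelMatrix θ x *ᵥ u + (σ ^ 2 / α) • u := by
    rw [← regGram_mulVec, hu, regGram_mulVec_temperedInv θ x hl]
  have h1 := (posSemidef_kernelMatrix θ x).dotProduct_mulVec_nonneg u
  rw [star_trivial] at h1
  have h2 := dotProduct_self_nonneg' (kernelMatrix θ x *ᵥ u)
  have h3 : ridgeGain σ α θ x y = (kernelMatrix θ x *ᵥ u) ⬝ᵥ (kernelMatrix θ x *ᵥ u) +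
      σ ^ 2 / α * (u ⬝ᵥ kernelMatrix θ x *ᵥ u) := by
    rw [ridgeGain, ← hu, hy]
    simp only [add_dotProduct, dotProduct_add, smul_dotProduct, dotProduct_smul, smul_eq_mul]
    rw [dotProduct_comm (kernelMatrix θ x *ᵥ u) u]
    ring
  rw [h3]
  positivity

lemma regGram_mulVec_snoc (l : ℝ) (u : Fin n → ℝ) (r : ℝ) :
    regGram l θ x *ᵥ (Fin.snoc u r : Fin (n + 1) → ℝ) =
      Fin.snoc (regGram l θ (initPts x) *ᵥ u + r • kernelVec θ (initPts x) (x (Fin.last n)))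
        (kernelVec θ (initPts x) (x (Fin.last n)) ⬝ᵥ u + (1 + l) * r) := by
  rw [regGram_mulVec, regGram_mulVec]
  ext i
  refine Fin.lastCases ?_ (fun i => ?_) i
  · simp [Matrix.mulVec, dotProduct, Fin.sum_univ_castSucc, kernelMatrix, kernelVec,
      seKernel_comm θ (x (Fin.last n))]
    ring
  · simp [Matrix.mulVec, dotProduct, Fin.sum_univ_castSucc, kernelMatrix, kernelVec]
    ring

lemma dotProduct_snoc (u v : Fin n → ℝ) (r s : ℝ) :
    (Fin.snoc u r : Fin (n + 1) → ℝ) ⬝ᵥ (Fin.snoc v s : Fin (n + 1) → ℝ) = u ⬝ᵥ v + r * s := by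
  simp [dotProduct, Fin.sum_univ_castSucc]

/-- Divided by 2σ², the increment is the exponent of the density ratio at e of N(m, σ²(1 + s/l)) to
N(0, σ²), where m and s are the predictive mean and variance. This makes the likelihood ratio
factorise over rounds. -/
lemma ridgeGain_snoc (hl : 0 < σ ^ 2 / α) (y : Fin n → ℝ) (e : ℝ) :
    ridgeGain σ α θ x (Fin.snoc y e : Fin (n + 1) → ℝ) = ridgeGain σ α θ (initPts x) y +
      (e ^ 2 - σ ^ 2 / α * (e - postMean σ α θ (initPts x) y (x (Fin.last n))) ^ 2 /
        (σ ^ 2 / α + postCov σ α θ (initPts x) (x (Fin.last n)) (x (Fin.last n)))) := by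
  set z := x (Fin.last n) with hz
  set m := postMean σ α θ (initPts x) y z with hm
  set s := postCov σ α θ (initPts x) z z with hs
  have hs0 : 0 ≤ s := postCov_nonneg θ (initPts x) z hl
  set r := (e - m) / (σ ^ 2 / α + s) with hr
  have hr' : r * (σ ^ 2 / α + s) = e - m := div_mul_cancel₀ _ (by linarith)
  have h1 : temperedInv σ α θ x *ᵥ (Fin.snoc y e : Fin (n + 1) → ℝ) =
      (Fin.snoc (temperedInv σ α θ (initPts x) *ᵥ y - r • postWeights θ (initPts x) z σ α) r :
        Fin (n + 1) → ℝ) := by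
    refine temperedInv_mulVec_eq θ x hl ?_
    rw [regGram_mulVec_snoc]
    congr 1
    · rw [Matrix.mulVec_sub, Matrix.mulVec_smul, postWeights,
        regGram_mulVec_temperedInv _ _ hl, regGram_mulVec_temperedInv _ _ hl, hz]
      simp
    · rw [← hz, dotProduct_sub, dotProduct_smul, smul_eq_mul]
      have h2 : kernelVec θ (initPts x) z ⬝ᵥ (temperedInv σ α θ (initPts x) *ᵥ y) = m := rfl
      have h3 : kernelVec θ (initPts x) z ⬝ᵥ postWeights θ (initPts x) z σ α = 1 - s := by
        rw [hs, postCov, seKernel_self, ← postWeights]; ring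
      rw [h2, h3]
      linarith
  have h4 : y ⬝ᵥ postWeights θ (initPts x) z σ α = m := by
    rw [hm, postMean_eq θ _ z hl, dotProduct_comm]
  rw [ridgeGain, ridgeGain, h1, dotProduct_snoc, dotProduct_snoc, dotProduct_sub,
    dotProduct_smul, h4, mul_div_assoc,
    show (e - m) ^ 2 / (σ ^ 2 / α + s) = (e - m) * r by rw [hr]; ring, smul_eq_mul]
  ring

end Recursion

/-! ### Bounds on posterior variance, posterior mean and ridge gain -/

section Bounds

variable {d n : ℕ} {σ α : ℝ} (θ : Fin d → ℝ) (x : Fin n → EuclideanSpace ℝ (Fin d))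
  (z : EuclideanSpace ℝ (Fin d))

/-- Cauchy–Schwarz in the RKHS against k_z, which has norm one. Scaling w so that its pairing with
k_z is 1 turns nonnegativity of the residual into the inequality. -/
lemma sq_dotProduct_kernelVec_le (w : Fin n → ℝ) :
    (w ⬝ᵥ kernelVec θ x z) ^ 2 ≤ w ⬝ᵥ kernelMatrix θ x *ᵥ w := by
  set a := w ⬝ᵥ kernelVec θ x z with ha
  have h0 := (posSemidef_kernelMatrix θ x).dotProduct_mulVec_nonneg w
  rw [star_trivial] at h0
  by_cases ha0 : a = 0
  · rw [ha0]; simpa using h0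
  have h := residual_nonneg θ x z (a⁻¹ • w)
  simp only [residual, smul_dotProduct, Matrix.mulVec_smul, dotProduct_smul, smul_eq_mul] at h
  rw [← ha, inv_mul_cancel₀ ha0] at h
  have h2 : 0 < a ^ 2 := by positivity
  have h3 : 1 ≤ a⁻¹ * (a⁻¹ * (w ⬝ᵥ kernelMatrix θ x *ᵥ w)) := by linarith
  calc a ^ 2 = a ^ 2 * 1 := (mul_one _).symm
    _ ≤ a ^ 2 * (a⁻¹ * (a⁻¹ * (w ⬝ᵥ kernelMatrix θ x *ᵥ w))) := by gcongr
    _ = _ := by field_simp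

/-- The posterior variance after `n` observations is at least `l / (n + l)`. -/
lemma le_postCov (hl : 0 < σ ^ 2 / α) :
    σ ^ 2 / α / (n + σ ^ 2 / α) ≤ postCov σ α θ x z z := by
  rw [postCov_eq θ x z hl]
  set w := postWeights θ x z σ α
  set l := σ ^ 2 / α
  have h1 := sq_dotProduct_kernelVec_le θ x z w
  set a := w ⬝ᵥ kernelVec θ x z with ha
  have h2 : a ^ 2 ≤ n * (w ⬝ᵥ w) := by
    have : ∀ i, (w i * kernelVec θ x z i) ^ 2 ≤ w i * w i := by
      intro i
      have h3 := (seKernel_pos θ (x i) z).le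
      have h4 := seKernel_le_one θ (x i) z
      have h5 : kernelVec θ x z i ^ 2 ≤ 1 := pow_le_one₀ h3 h4
      rw [mul_pow, sq (w i)]
      exact mul_le_of_le_one_right (mul_self_nonneg _) h5
    calc a ^ 2 ≤ n * ∑ i, (w i * kernelVec θ x z i) ^ 2 := by
          simpa [ha, dotProduct] using
            sq_sum_le_card_mul_sum_sq (s := Finset.univ) (f := fun i => w i * kernelVec θ x z i)
      _ ≤ n * (w ⬝ᵥ w) := by
          gcongr
          exact Finset.sum_le_sum fun i _ => this i
  have hw := dotProduct_self_nonneg' w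
  set q := w ⬝ᵥ w
  rw [residual, ← ha, div_le_iff₀ (by positivity)]
  rcases Nat.eq_zero_or_pos n with hn | hn
  · have h3 : (n : ℝ) = 0 := by exact_mod_cast hn
    rw [h3] at h2 ⊢
    have ha0 : a = 0 := by nlinarith
    rw [ha0] at h1 ⊢
    nlinarith [mul_nonneg hl.le hw]
  · have hn' : (0 : ℝ) < n := by exact_mod_cast hn
    have h3 : (1 - a) ^ 2 + l * q ≤ 1 - 2 * a + w ⬝ᵥ kernelMatrix θ x *ᵥ w + l * q := by linarith
    refine le_trans ?_ (mul_le_mul_of_nonneg_right h3 (by positivity))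
    -- The variance is at least (1-a)² + l a²/n, whose minimum over a is l/(n+l) at a = n/(n+l),
    -- where the square below vanishes.
    have h4 : 0 ≤ n * (n * (1 - a) ^ 2 + l ^ 2 * q - 2 * l * a * (1 - a)) := by
      nlinarith [sq_nonneg (n * (1 - a) - l * a), mul_le_mul_of_nonneg_left h2 (sq_nonneg l)]
    have h5 := nonneg_of_mul_nonneg_right h4 hn'
    nlinarith [mul_le_mul_of_nonneg_left h2 hl.le]

lemma postCov_pos (hl : 0 < σ ^ 2 / α) : 0 < postCov σ α θ x z z :=
  lt_of_lt_of_le (by positivity) (le_postCov θ x z hl)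

/-- The posterior mean of a data vector is controlled by its ridge gain. -/
lemma postMean_sq_le (hl : 0 < σ ^ 2 / α) (y : Fin n → ℝ) :
    postMean σ α θ x y z ^ 2 ≤ postCov σ α θ x z z * ((σ ^ 2 / α)⁻¹ * ridgeGain σ α θ x y) := by
  have hs := postCov_pos θ x z hl
  -- Appending a fictitious observation e at z keeps the ridge gain nonnegative, whatever e is.
  have key : ∀ e, 0 ≤ ridgeGain σ α θ x y + (e ^ 2 - σ ^ 2 / α * (e - postMean σ α θ x y z) ^ 2 /
      (σ ^ 2 / α + postCov σ α θ x z z)) := by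
    intro e
    have h := ridgeGain_nonneg hl θ (Fin.snoc x z : Fin (n + 1) → EuclideanSpace ℝ (Fin d))
      (Fin.snoc y e)
    have hi : initPts (Fin.snoc x z : Fin (n + 1) → EuclideanSpace ℝ (Fin d)) = x := by
      funext i; simp [initPts]
    rw [ridgeGain_snoc θ _ hl, hi] at h
    simpa using h
  set m := postMean σ α θ x y z
  set s := postCov σ α θ x z z
  set l := σ ^ 2 / α
  -- This e minimises the quadratic in `key`.
  have h := key (-(l * m / s))
  have h2 : (-(l * m / s)) ^ 2 - l * (-(l * m / s) - m) ^ 2 / (l + s) = -(l * m ^ 2 / s) := by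
    field_simp
    ring
  rw [h2] at h
  have h3 : l * m ^ 2 / s ≤ ridgeGain σ α θ x y := by linarith
  rw [div_le_iff₀ hs] at h3
  calc m ^ 2 = l⁻¹ * (l * m ^ 2) := by field_simp
    _ ≤ l⁻¹ * (ridgeGain σ α θ x y * s) := by gcongr
    _ = _ := by ring

/-- Completing the square: for positive definite A, yᵀA⁻¹y is the maximum over u of 2u·y - uᵀAu. -/
lemma le_dotProduct_temperedInv (hl : 0 < σ ^ 2 / α) (y u : Fin n → ℝ) :
    2 * (u ⬝ᵥ y) - u ⬝ᵥ regGram (σ ^ 2 / α) θ x *ᵥ u ≤ y ⬝ᵥ (temperedInv σ α θ x *ᵥ y) := by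
  set v := temperedInv σ α θ x *ᵥ y with hv
  have h := (posDef_regGram hl θ x).posSemidef.dotProduct_mulVec_nonneg (u - v)
  have h2 : regGram (σ ^ 2 / α) θ x *ᵥ v = y := regGram_mulVec_temperedInv θ x hl y
  have h3 : v ⬝ᵥ regGram (σ ^ 2 / α) θ x *ᵥ u = u ⬝ᵥ y := by
    rw [dotProduct_regGram_mulVec_comm, h2]
  rw [star_trivial, Matrix.mulVec_sub, dotProduct_sub, sub_dotProduct, sub_dotProduct, h2, h3,
    dotProduct_comm v y] at h
  linarith

/-- The ridge gain is monotone up to constants in the kernel. -/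
lemma ridgeGain_le_mul (hl : 0 < σ ^ 2 / α) {θ θ' : Fin d → ℝ} {C : ℝ} (hC : 1 ≤ C)
    (h : ∀ v : Fin n → ℝ, v ⬝ᵥ kernelMatrix θ x *ᵥ v ≤ C * (v ⬝ᵥ kernelMatrix θ' x *ᵥ v))
    (y : Fin n → ℝ) : ridgeGain σ α θ x y ≤ C * ridgeGain σ α θ' x y := by
  -- The ridge gain is the minimum over u of |y - lu|² + l uᵀKu. The minimiser for θ' is tried for
  -- θ; `1 ≤ C` takes care of the first summand.
  set u := temperedInv σ α θ' x *ᵥ y with hu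
  have h1 := le_dotProduct_temperedInv θ x hl y u
  have h2 : u ⬝ᵥ regGram (σ ^ 2 / α) θ' x *ᵥ u = u ⬝ᵥ y := by
    rw [hu, regGram_mulVec_temperedInv θ' x hl]
  rw [regGram_mulVec, dotProduct_add, dotProduct_smul, smul_eq_mul] at h1 h2
  have h3 := h u
  rw [ridgeGain, ridgeGain, ← hu]
  have h4 := dotProduct_self_nonneg' (y - (σ ^ 2 / α) • u)
  simp only [sub_dotProduct, dotProduct_sub, smul_dotProduct, dotProduct_smul, smul_eq_mul] at h4
  rw [dotProduct_comm y u] at h4 ⊢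
  have h5 := mul_nonneg (sub_nonneg.2 hC) h4
  have h6 := mul_le_mul_of_nonneg_left h1 hl.le
  have h7 := mul_le_mul_of_nonneg_left h3 hl.le
  have h8 : C * (σ ^ 2 / α * (u ⬝ᵥ kernelMatrix θ' x *ᵥ u)) =
    C * (σ ^ 2 / α * (u ⬝ᵥ y - σ ^ 2 / α * (u ⬝ᵥ u))) := by rw [← h2]; ring
  nlinarith

end Bounds

/-! ### Information gain: monotonicity, stability, summed variances -/

section InfoGain

variable {d : ℕ} {X : Set (EuclideanSpace ℝ (Fin d))} {σ α : ℝ}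

lemma gainDet_le (hl : 0 < σ ^ 2 / α) (θ : Fin d → ℝ) :
    ∀ {n : ℕ} (x : Fin n → EuclideanSpace ℝ (Fin d)),
      gainDet σ α θ x ≤ (1 + (σ ^ 2 / α)⁻¹) ^ n
  | 0, x => by simp
  | n + 1, x => by
    rw [gainDet_succ θ x hl, pow_succ (1 + _) n]
    have h1 := gainDet_le hl θ (initPts x)
    have h2 := postCov_le_one θ (initPts x) (x (Fin.last n)) hl
    have h3 := postCov_nonneg θ (initPts x) (x (Fin.last n)) hl
    have h4 := (gainDet_pos hl θ (initPts x)).le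
    have h5 := inv_pos.2 hl
    generalize (σ ^ 2 / α)⁻¹ = q at h1 h5 ⊢
    refine mul_le_mul h1 ?_ (by positivity) (by positivity)
    linarith [mul_le_of_le_one_right h5.le h2]

lemma bddAbove_infoGain (hl : 0 < σ ^ 2 / α) (θ : Fin d → ℝ) (t : ℕ) :
    BddAbove (Set.range fun A : Fin t → X => 1 / 2 * Real.log
      (gainDet σ α θ (fun i => (A i : EuclideanSpace ℝ (Fin d))))) := by
  refine ⟨1 / 2 * Real.log ((1 + (σ ^ 2 / α)⁻¹) ^ t), ?_⟩
  rintro _ ⟨A, rfl⟩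
  have := Real.log_le_log (gainDet_pos hl θ _)
    (gainDet_le hl θ (fun i => (A i : EuclideanSpace ℝ (Fin d))))
  dsimp only
  linarith

lemma half_log_gainDet_le (hl : 0 < σ ^ 2 / α) (θ : Fin d → ℝ) {t : ℕ}
    (x : Fin t → EuclideanSpace ℝ (Fin d)) (hx : ∀ i, x i ∈ X) :
    1 / 2 * Real.log (gainDet σ α θ x) ≤ infoGain X σ α θ t :=
  le_ciSup (bddAbove_infoGain hl θ t) (fun i => (⟨x i, hx i⟩ : X))

lemma gainDet_le_gainDet (hl : 0 < σ ^ 2 / α) {θ θ' : Fin d → ℝ} (hθ' : ∀ i, 0 < θ' i)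
    (h : ∀ i, θ' i ≤ θ i) :
    ∀ {n : ℕ} (x : Fin n → EuclideanSpace ℝ (Fin d)), gainDet σ α θ x ≤ gainDet σ α θ' x
  | 0, x => by simp
  | n + 1, x => by
    rw [gainDet_succ θ x hl, gainDet_succ θ' x hl]
    have h1 := gainDet_le_gainDet hl hθ' h (initPts x)
    have h2 := postCov_le_postCov (initPts x) (x (Fin.last n)) hl hθ' h
    have h3 := postCov_nonneg θ (initPts x) (x (Fin.last n)) hl
    have h4 := (gainDet_pos hl θ' (initPts x)).le
    gcongr

/-- Summed posterior variances of close kernels: the log determinants are close. -/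
lemma log_gainDet_le_add (hl : 0 < σ ^ 2 / α) {θ θ' : Fin d → ℝ} {η : ℝ} (hη : 0 ≤ η)
    (h : ∀ y ∈ X, ∀ z ∈ X, |seKernel θ' y z - seKernel θ y z| ≤ η) (N : ℕ) :
    ∀ {n : ℕ}, n ≤ N → ∀ (x : Fin n → EuclideanSpace ℝ (Fin d)), (∀ i, x i ∈ X) →
      Real.log (gainDet σ α θ' x) ≤ Real.log (gainDet σ α θ x) +
        n * ((σ ^ 2 / α)⁻¹ * (η * (N * (1 + (σ ^ 2 / α)⁻¹))))
  | 0, _, x, _ => by simp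
  | n + 1, hn, x, hx => by
    have h1 := log_gainDet_le_add hl hη h N (n.le_succ.trans hn) (initPts x) fun i => hx _
    have h3 := postCov_nonneg θ (initPts x) (x (Fin.last n)) hl
    have h3' := postCov_nonneg θ' (initPts x) (x (Fin.last n)) hl
    have hli := inv_pos.2 hl
    have h2 : postCov σ α θ' (initPts x) (x (Fin.last n)) (x (Fin.last n)) ≤
        postCov σ α θ (initPts x) (x (Fin.last n)) (x (Fin.last n)) +
          η * (N * (1 + (σ ^ 2 / α)⁻¹)) := by
      refine (postCov_le_add (initPts x) (x (Fin.last n)) hl (θ := θ) hη fun i j => ?_).trans ?_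
      · have hmem : ∀ i, extend (initPts x) (x (Fin.last n)) i ∈ X := by
          rintro (i | i)
          · exact hx _
          · exact hx _
        exact h _ (hmem i) _ (hmem j)
      · have : (n : ℝ) + 1 ≤ N := by exact_mod_cast hn
        gcongr
    rw [gainDet_succ θ x hl, gainDet_succ θ' x hl,
      Real.log_mul (gainDet_pos hl _ _).ne' (by positivity),
      Real.log_mul (gainDet_pos hl _ _).ne' (by positivity)]
    have h4 : Real.log (1 + (σ ^ 2 / α)⁻¹ *
        postCov σ α θ' (initPts x) (x (Fin.last n)) (x (Fin.last n))) ≤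
        Real.log (1 + (σ ^ 2 / α)⁻¹ *
        postCov σ α θ (initPts x) (x (Fin.last n)) (x (Fin.last n))) +
        (σ ^ 2 / α)⁻¹ * (η * (N * (1 + (σ ^ 2 / α)⁻¹))) := by
      set s := postCov σ α θ (initPts x) (x (Fin.last n)) (x (Fin.last n))
      set s' := postCov σ α θ' (initPts x) (x (Fin.last n)) (x (Fin.last n))
      set c := η * (N * (1 + (σ ^ 2 / α)⁻¹)) with hc
      have hc0 : 0 ≤ c := by positivity
      set q := (σ ^ 2 / α)⁻¹
      have hq : 0 ≤ q := hli.le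
      -- Uses 1 + q(s + c) ≤ (1 + qs)(1 + qc) and log(1 + qc) ≤ qc.
      calc Real.log (1 + q * s') ≤ Real.log ((1 + q * s) * (1 + q * c)) := by
            refine Real.log_le_log (by positivity) ?_
            nlinarith [mul_nonneg (mul_nonneg hq h3) (mul_nonneg hq hc0),
              mul_le_mul_of_nonneg_left h2 hq]
        _ = Real.log (1 + q * s) + Real.log (1 + q * c) :=
            Real.log_mul (by positivity) (by positivity)
        _ ≤ _ := by
            gcongr
            have := Real.log_le_sub_one_of_pos (show 0 < 1 + q * c by positivity)
            linarith
    push_cast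
    linarith

variable [Nonempty X]

lemma infoGain_nonneg (hl : 0 < σ ^ 2 / α) (θ : Fin d → ℝ) (t : ℕ) :
    0 ≤ infoGain X σ α θ t := by
  obtain ⟨z⟩ := ‹Nonempty X›
  refine le_trans ?_ (half_log_gainDet_le hl θ (fun _ : Fin t => (z : EuclideanSpace ℝ (Fin d)))
    fun _ => z.2)
  have : ∀ n : ℕ, ∀ x : Fin n → EuclideanSpace ℝ (Fin d), 1 ≤ gainDet σ α θ x := by
    intro n
    induction n with
    | zero => intro x; simp
    | succ n ih =>
      intro x
      rw [gainDet_succ θ x hl]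
      have h3 := postCov_nonneg θ (initPts x) (x (Fin.last n)) hl
      have hli := inv_pos.2 hl
      exact one_le_mul_of_one_le_of_one_le (ih _) (by linarith [mul_nonneg hli.le h3])
  have := Real.log_nonneg (this t fun _ => z)
  linarith

lemma infoGain_anti (hl : 0 < σ ^ 2 / α) {θ θ' : Fin d → ℝ} (hθ' : ∀ i, 0 < θ' i)
    (h : ∀ i, θ' i ≤ θ i) (t : ℕ) : infoGain X σ α θ t ≤ infoGain X σ α θ' t := by
  refine ciSup_le fun A => ?_
  refine le_trans ?_ (half_log_gainDet_le hl θ' _ fun i => (A i).2)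
  have := Real.log_le_log (gainDet_pos hl θ _) (gainDet_le_gainDet hl hθ' h
    fun i => (A i : EuclideanSpace ℝ (Fin d)))
  rw [← gainDet]
  linarith

lemma infoGain_mono (hl : 0 < σ ^ 2 / α) (θ : Fin d → ℝ) :
    Monotone (infoGain X σ α θ) := by
  refine monotone_nat_of_le_succ fun t => ciSup_le fun A => ?_
  obtain ⟨z⟩ := ‹Nonempty X›
  have h := half_log_gainDet_le (X := X) hl θ
    (Fin.snoc (fun i => (A i : EuclideanSpace ℝ (Fin d))) (z : EuclideanSpace ℝ (Fin d)) :
      Fin (t + 1) → EuclideanSpace ℝ (Fin d)) (fun i => by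
        refine Fin.lastCases ?_ (fun i => ?_) i
        · simp
        · simp)
  refine le_trans ?_ h
  rw [gainDet_succ θ _ hl]
  have hi : initPts (Fin.snoc (fun i => (A i : EuclideanSpace ℝ (Fin d)))
      (z : EuclideanSpace ℝ (Fin d)) : Fin (t + 1) → EuclideanSpace ℝ (Fin d)) =
      fun i => (A i : EuclideanSpace ℝ (Fin d)) := by
    funext i; simp [initPts]
  rw [hi, ← gainDet]
  have h3 := postCov_nonneg θ (fun i => (A i : EuclideanSpace ℝ (Fin d)))
    ((Fin.snoc (fun i => (A i : EuclideanSpace ℝ (Fin d))) (z : EuclideanSpace ℝ (Fin d)) :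
      Fin (t + 1) → EuclideanSpace ℝ (Fin d)) (Fin.last t)) hl
  have hp := gainDet_pos hl θ (fun i => (A i : EuclideanSpace ℝ (Fin d)))
  have hli := inv_pos.2 hl
  have := Real.log_le_log hp (le_mul_of_one_le_right hp.le
    (by linarith [mul_nonneg hli.le h3] : 1 ≤ 1 + (σ ^ 2 / α)⁻¹ * postCov σ α θ
      (fun i => (A i : EuclideanSpace ℝ (Fin d))) _ _))
  linarith

/-- The information gain of at least one observation is positive. -/
lemma le_infoGain (hl : 0 < σ ^ 2 / α) (θ : Fin d → ℝ) {t : ℕ} (ht : 1 ≤ t) :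
    1 / 2 * Real.log (1 + (σ ^ 2 / α)⁻¹) ≤ infoGain X σ α θ t := by
  refine le_trans ?_ (infoGain_mono hl θ ht)
  obtain ⟨z⟩ := ‹Nonempty X›
  refine le_trans (le_of_eq ?_) (half_log_gainDet_le hl θ
    (fun _ : Fin 1 => (z : EuclideanSpace ℝ (Fin d))) fun _ => z.2)
  rw [gainDet_succ θ _ hl, gainDet_zero]
  simp [postCov]

/-- The posterior variances along a sequence of points sum up to at most the information gain. -/
lemma sum_postCov_le (hl : 0 < σ ^ 2 / α) (θ : Fin d → ℝ)
    (x : ℕ → EuclideanSpace ℝ (Fin d)) (T : ℕ) :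
    ∑ t ∈ Finset.range T, postCov σ α θ (fun i : Fin t => x i) (x t) (x t) ≤
      (σ ^ 2 / α + 1) * Real.log (gainDet σ α θ fun i : Fin T => x i) := by
  induction T with
  | zero => simp
  | succ T ih =>
    rw [Finset.sum_range_succ, gainDet_succ θ _ hl]
    have h1 : initPts (fun i : Fin (T + 1) => x i) = fun i : Fin T => x i := rfl
    rw [h1]
    simp only [Fin.val_last]
    have h2 := postCov_le_one θ (fun i : Fin T => x i) (x T) hl
    have h3 := postCov_nonneg θ (fun i : Fin T => x i) (x T) hl
    set s := postCov σ α θ (fun i : Fin T => x i) (x T) (x T)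
    rw [Real.log_mul (gainDet_pos hl _ _).ne' (by positivity), mul_add]
    refine add_le_add ih ?_
    set l := σ ^ 2 / α
    have h4 := Real.one_sub_inv_le_log_of_pos (show 0 < 1 + l⁻¹ * s by positivity)
    -- Since s ≤ 1, s ≤ (l+1) · s/(l+s), and s/(l+s) = 1 - (1 + s/l)⁻¹ ≤ log(1 + s/l).
    calc s ≤ (l + 1) * (1 - (1 + l⁻¹ * s)⁻¹) := by
          have : 1 - (1 + l⁻¹ * s)⁻¹ = s / (l + s) := by
            field_simp
            ring
          rw [this, mul_div_assoc', le_div_iff₀ (by positivity)]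
          nlinarith
      _ ≤ _ := by gcongr

end InfoGain

/-! ### The confidence scale -/

section MScale

variable {d : ℕ} {X : Set (EuclideanSpace ℝ (Fin d))} {σ α δ : ℝ}

lemma one_le_log_mScale (h0 : 0 < δ) (h1 : δ < 1) {t : ℕ} (ht : 1 ≤ t) :
    1 ≤ Real.log (2 * (t : ℝ) ^ 2 * Real.pi ^ 2 / (3 * δ)) := by
  have ht' : (1 : ℝ) ≤ t := by exact_mod_cast ht
  have hpi := Real.pi_gt_three
  rw [Real.le_log_iff_exp_le (by positivity)]
  refine Real.exp_one_lt_d9.le.trans ?_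
  rw [le_div_iff₀ (by positivity)]
  nlinarith [mul_le_mul ht' ht' (by norm_num) (by linarith)]

/-- This lower bound lets the bias, proportional to ‖f‖, be absorbed into a multiple of `mScale`. -/
lemma sqrt_le_mScale (h0 : 0 < δ) (h1 : δ < 1) (θ : Fin d → ℝ) {t : ℕ} (ht : 1 ≤ t) :
    √α ≤ mScale X σ α δ θ t := by
  rw [mScale]
  refine le_mul_of_one_le_right (Real.sqrt_nonneg _) ?_
  have := Real.one_le_sqrt.2 (one_le_log_mScale h0 h1 ht)
  linarith [Real.sqrt_nonneg (infoGain X σ α θ (t - 1))]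

lemma mScale_le_mScale [Nonempty X] (hl : 0 < σ ^ 2 / α) (h0 : 0 < δ)
    {θ θ' : Fin d → ℝ} (hθ' : ∀ i, 0 < θ' i) (h : ∀ i, θ' i ≤ θ i) {t T : ℕ} (ht : 1 ≤ t)
    (hT : t ≤ T) : mScale X σ α δ θ t ≤ mScale X σ α δ θ' T := by
  have ht' : (1 : ℝ) ≤ t := by exact_mod_cast ht
  have hpi := Real.pi_pos
  rw [mScale, mScale]
  gcongr
  exact (infoGain_anti hl hθ' h _).trans (infoGain_mono hl θ' (by omega))

end MScale

/-! ### The function τ_g and its inverse -/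

section Tau

variable {g : ℝ}

lemma stdPDF_eq (u : ℝ) :
    gaussianPDFReal 0 1 u = (√(2 * Real.pi))⁻¹ * Real.exp (-u ^ 2 / 2) := by
  simp [gaussianPDFReal]

lemma continuous_stdPDF : Continuous (gaussianPDFReal 0 1) := by
  simp_rw [funext stdPDF_eq]; fun_prop

lemma tau_eq_shift (g v : ℝ) :
    tau g v = ∫ s in Set.Ioi (0 : ℝ), s ^ g * gaussianPDFReal 0 1 (s + v) := by
  rw [tau]
  have h := (measurePreserving_add_right volume v).setIntegral_preimage_emb
    (measurableEmbedding_addRight v) (fun u => (u - v) ^ g * gaussianPDFReal 0 1 u) (Set.Ioi v)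
  simpa using h.symm

lemma integrableOn_shift (hg : 0 ≤ g) (v : ℝ) :
    IntegrableOn (fun s => s ^ g * gaussianPDFReal 0 1 (s + v)) (Set.Ioi 0) := by
  have h := (integrableOn_rpow_mul_exp_neg_mul_sq (b := 1 / 4) (by norm_num)
    (show -1 < g by linarith)).const_mul ((√(2 * Real.pi))⁻¹ * Real.exp (v ^ 2 / 2))
  refine Integrable.mono' h ?_ ?_
  · refine (Continuous.mul ?_ ?_).aestronglyMeasurable
    · exact continuous_id.rpow_const fun _ => Or.inr hg
    · exact continuous_stdPDF.comp (continuous_id.add continuous_const)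
  · filter_upwards [ae_restrict_mem measurableSet_Ioi] with s hs
    have hs0 : (0 : ℝ) ≤ s ^ g := Real.rpow_nonneg (le_of_lt hs) _
    rw [Real.norm_of_nonneg (mul_nonneg hs0 (gaussianPDFReal_nonneg _ _ _)), stdPDF_eq]
    -- The exponents differ by (s + 2v)²/4.
    have h1 : Real.exp (-(s + v) ^ 2 / 2) ≤ Real.exp (v ^ 2 / 2) * Real.exp (-(1 / 4) * s ^ 2) := by
      rw [← Real.exp_add, Real.exp_le_exp]
      nlinarith [sq_nonneg (s + 2 * v)]
    calc s ^ g * ((√(2 * Real.pi))⁻¹ * Real.exp (-(s + v) ^ 2 / 2)) ≤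
        s ^ g * ((√(2 * Real.pi))⁻¹ * (Real.exp (v ^ 2 / 2) * Real.exp (-(1 / 4) * s ^ 2))) := by
          gcongr
      _ = _ := by ring

lemma integrableOn_tau (hg : 0 ≤ g) (v : ℝ) :
    IntegrableOn (fun u => (u - v) ^ g * gaussianPDFReal 0 1 u) (Set.Ioi v) := by
  have h := (integrableOn_shift hg v)
  refine ((measurePreserving_add_right volume v).integrableOn_comp_preimage
    (measurableEmbedding_addRight v)).1 ?_
  simpa [Function.comp_def] using h

lemma tau_pos (hg : 0 ≤ g) (v : ℝ) : 0 < tau g v := by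
  rw [tau_eq_shift, setIntegral_pos_iff_support_of_nonneg_ae]
  · have : Set.Ioi (0 : ℝ) ⊆ Function.support
        (fun s => s ^ g * gaussianPDFReal 0 1 (s + v)) ∩ Set.Ioi 0 := by
      intro s hs
      refine ⟨?_, hs⟩
      exact (mul_pos (Real.rpow_pos_of_pos hs _) (gaussianPDFReal_pos _ _ _ one_ne_zero)).ne'
    exact lt_of_lt_of_le (by simp) (measure_mono this)
  · filter_upwards [ae_restrict_mem measurableSet_Ioi] with s hs
    exact mul_nonneg (Real.rpow_nonneg (le_of_lt hs) _) (gaussianPDFReal_nonneg _ _ _)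
  · exact integrableOn_shift hg v

lemma strictAnti_tau (hg : 0 ≤ g) : StrictAnti (tau g) := by
  intro v v' hv
  have hi := integrableOn_tau hg v
  have hs : Set.Ioi v = Set.Ioc v v' ∪ Set.Ioi v' := (Set.Ioc_union_Ioi_eq_Ioi hv.le).symm
  have h1 : tau g v = (∫ u in Set.Ioc v v', (u - v) ^ g * gaussianPDFReal 0 1 u) +
      ∫ u in Set.Ioi v', (u - v) ^ g * gaussianPDFReal 0 1 u := by
    rw [tau, hs, setIntegral_union (Set.Ioc_disjoint_Ioi le_rfl) measurableSet_Ioi]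
    · exact hi.mono_set (hs ▸ Set.subset_union_left)
    · exact hi.mono_set (hs ▸ Set.subset_union_right)
  have h2 : tau g v' ≤ ∫ u in Set.Ioi v', (u - v) ^ g * gaussianPDFReal 0 1 u := by
    refine setIntegral_mono_on (integrableOn_tau hg v')
      (hi.mono_set (hs ▸ Set.subset_union_right)) measurableSet_Ioi fun u hu => ?_
    have hu' : v' < u := hu
    refine mul_le_mul_of_nonneg_right ?_ (gaussianPDFReal_nonneg _ _ _)
    exact Real.rpow_le_rpow (by linarith) (by linarith) hg
  have h3 : 0 < ∫ u in Set.Ioc v v', (u - v) ^ g * gaussianPDFReal 0 1 u := by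
    rw [← intervalIntegral.integral_of_le hv.le]
    refine intervalIntegral.intervalIntegral_pos_of_pos_on ?_ (fun u hu => ?_) hv
    · rw [intervalIntegrable_iff_integrableOn_Ioc_of_le hv.le]
      exact hi.mono_set (hs ▸ Set.subset_union_left)
    · exact mul_pos (Real.rpow_pos_of_pos (by linarith [hu.1]) _)
        (gaussianPDFReal_pos _ _ _ one_ne_zero)
  linarith

lemma tau_zero (hg : 0 ≤ g) : tau g 0 = gConst g := by
  rw [tau_eq_shift]
  have h := integral_rpow_mul_exp_neg_mul_rpow (p := 2) (q := g) (b := 1 / 2) (by norm_num)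
    (by linarith) (by norm_num)
  have h1 : ∀ s : ℝ, s ^ g * gaussianPDFReal 0 1 (s + 0) =
      (√(2 * Real.pi))⁻¹ * (s ^ g * Real.exp (-(1 / 2) * s ^ (2 : ℝ))) := by
    intro s
    rw [stdPDF_eq, add_zero, Real.rpow_two]
    ring_nf
  simp_rw [h1]
  rw [integral_const_mul, h, gConst]
  have h2 : (1 / 2 : ℝ) ^ (-(g + 1) / 2) = 2 ^ (g / 2) * √2 := by
    rw [one_div, Real.inv_rpow (by norm_num), ← Real.rpow_neg (by norm_num), Real.sqrt_eq_rpow,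
      ← Real.rpow_add (by norm_num)]
    congr 1; ring
  rw [h2, Real.sqrt_mul (by norm_num)]
  have hpi : √Real.pi ≠ 0 := (Real.sqrt_pos.2 Real.pi_pos).ne'
  have h22 : √(2 : ℝ) ≠ 0 := by positivity
  field_simp

lemma gConst_pos (hg : 0 ≤ g) : 0 < gConst g := by
  rw [← tau_zero hg]; exact tau_pos hg 0

/-- For v ≥ 0 the shifted integrand is dominated by the one at v = 0; this half-line suffices for
inverting on (0, C_(g)]. -/
lemma continuousOn_tau (hg : 0 ≤ g) : ContinuousOn (tau g) (Set.Ici 0) := by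
  rw [funext (tau_eq_shift g)]
  refine continuousOn_of_dominated (bound := fun s => s ^ g * gaussianPDFReal 0 1 (s + 0)) ?_ ?_
    (integrableOn_shift hg 0) ?_
  · exact fun v _ => (integrableOn_shift hg v).aestronglyMeasurable
  · intro v hv
    filter_upwards [ae_restrict_mem measurableSet_Ioi] with s hs
    have hs' : (0 : ℝ) < s := hs
    have hv' : (0 : ℝ) ≤ v := hv
    have hs0 : (0 : ℝ) ≤ s ^ g := Real.rpow_nonneg hs'.le _
    rw [Real.norm_of_nonneg (mul_nonneg hs0 (gaussianPDFReal_nonneg _ _ _)), stdPDF_eq, stdPDF_eq]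
    gcongr
  · filter_upwards with s
    exact (continuous_const.mul (continuous_stdPDF.comp
      (continuous_const.add continuous_id))).continuousOn

lemma tau_le_exp_mul (hg : 0 ≤ g) {v : ℝ} (hv : 0 ≤ v) :
    tau g v ≤ Real.exp (-v ^ 2 / 2) * tau g 0 := by
  rw [tau_eq_shift, tau_eq_shift, ← integral_const_mul]
  refine setIntegral_mono_on (integrableOn_shift hg v) ((integrableOn_shift hg 0).const_mul _)
    measurableSet_Ioi fun s hs => ?_
  have hs' : (0 : ℝ) < s := hs
  rw [stdPDF_eq, stdPDF_eq]
  have h1 : Real.exp (-(s + v) ^ 2 / 2) ≤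
      Real.exp (-v ^ 2 / 2) * Real.exp (-(s + 0) ^ 2 / 2) := by
    rw [← Real.exp_add, Real.exp_le_exp]
    nlinarith [mul_nonneg hs'.le hv]
  have hs0 : (0 : ℝ) ≤ s ^ g := Real.rpow_nonneg hs'.le _
  calc _ ≤ s ^ g * ((√(2 * Real.pi))⁻¹ * (Real.exp (-v ^ 2 / 2) *
        Real.exp (-(s + 0) ^ 2 / 2))) := by gcongr
    _ = _ := by ring

lemma exists_tau_eq (hg : 0 ≤ g) {c : ℝ} (hc : 0 < c) (hc' : c ≤ gConst g) :
    ∃ v, 0 ≤ v ∧ tau g v = c := by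
  rw [← tau_zero hg] at hc'
  have h0 := tau_pos hg 0
  -- Chosen so that exp(V²/2) ≥ 1 + V²/2 ≥ V - 1 = τ_g(0)/c, which brings τ_g(V) below c.
  set V := tau g 0 / c + 1 with hV
  have hV0 : 0 ≤ V := by positivity
  have hVc : tau g V ≤ c := by
    refine (tau_le_exp_mul hg hV0).trans ?_
    have h1 : Real.exp (-V ^ 2 / 2) ≤ c / tau g 0 := by
      rw [neg_div, Real.exp_neg, ← inv_div (tau g 0) c]
      refine inv_anti₀ (div_pos h0 hc) ?_
      have h2 := Real.add_one_le_exp (V ^ 2 / 2)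
      have h3 : V - 1 = tau g 0 / c := by rw [hV]; ring
      rw [← h3]
      nlinarith [sq_nonneg (V - 1)]
    calc _ ≤ c / tau g 0 * tau g 0 := by gcongr
      _ = c := by field_simp
  obtain ⟨v, hv, hvc⟩ := intermediate_value_Icc' hV0
    ((continuousOn_tau hg).mono Set.Icc_subset_Ici_self) ⟨hVc, hc'⟩
  exact ⟨v, hv.1, hvc⟩

/-- On (0, C_(g)] the value of `Function.invFun` is a genuine preimage, not a default. -/
lemma tau_tauInv (hg : 0 ≤ g) {c : ℝ} (hc : 0 < c) (hc' : c ≤ gConst g) :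
    tau g (tauInv g c) = c :=
  Function.invFun_eq ((exists_tau_eq hg hc hc').imp fun _ h => h.2)

lemma tauInv_nonneg (hg : 0 ≤ g) {c : ℝ} (hc : 0 < c) (hc' : c ≤ gConst g) : 0 ≤ tauInv g c := by
  rw [← (strictAnti_tau hg).le_iff_ge, tau_tauInv hg hc hc', tau_zero hg]
  exact hc'

lemma le_tauInv (hg : 0 ≤ g) {c v : ℝ} (hc : 0 < c) (hc' : c ≤ gConst g) (h : c ≤ tau g v) :
    v ≤ tauInv g c := by
  rwa [← (strictAnti_tau hg).le_iff_ge, tau_tauInv hg hc hc']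

end Tau

/-! ### Continuity in the data, used for measurability -/

section Continuity

variable {d n : ℕ} {σ α : ℝ} (θ : Fin d → ℝ)

lemma continuous_kernelMatrix :
    Continuous fun x : Fin n → EuclideanSpace ℝ (Fin d) => kernelMatrix θ x := by
  refine continuous_matrix fun i j => ?_
  exact continuous_seKernel θ (continuous_apply i) (continuous_apply j)

lemma continuous_kernelVec :
    Continuous fun p : (Fin n → EuclideanSpace ℝ (Fin d)) × EuclideanSpace ℝ (Fin d) =>
      kernelVec θ p.1 p.2 := by
  refine continuous_pi fun i => ?_
  exact continuous_seKernel θ ((continuous_apply i).comp continuous_fst) continuous_snd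

lemma continuous_temperedInv (hl : 0 < σ ^ 2 / α) :
    Continuous fun x : Fin n → EuclideanSpace ℝ (Fin d) => temperedInv σ α θ x := by
  have h : Continuous fun x : Fin n → EuclideanSpace ℝ (Fin d) => regGram (σ ^ 2 / α) θ x :=
    (continuous_kernelMatrix θ).add continuous_const
  simp_rw [temperedInv_eq, Matrix.inv_def, Ring.inverse_eq_inv']
  exact (h.matrix_det.inv₀ fun x => (posDef_regGram hl θ x).det_pos.ne').smul h.matrix_adjugate

lemma continuous_postMean (hl : 0 < σ ^ 2 / α) :
    Continuous fun p : (Fin n → EuclideanSpace ℝ (Fin d)) × (Fin n → ℝ) ×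
      EuclideanSpace ℝ (Fin d) => postMean σ α θ p.1 p.2.1 p.2.2 :=
  ((continuous_kernelVec θ).comp (continuous_fst.prodMk continuous_snd.snd)).dotProduct
    (((continuous_temperedInv θ hl).comp continuous_fst).matrix_mulVec continuous_snd.fst)

lemma continuous_postCov (hl : 0 < σ ^ 2 / α) :
    Continuous fun p : (Fin n → EuclideanSpace ℝ (Fin d)) × EuclideanSpace ℝ (Fin d) =>
      postCov σ α θ p.1 p.2 p.2 := by
  simp only [postCov, seKernel_self]
  exact continuous_const.sub ((continuous_kernelVec θ).dotProduct
    (((continuous_temperedInv θ hl).comp continuous_fst).matrix_mulVec (continuous_kernelVec θ)))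

lemma continuous_gainDet :
    Continuous fun x : Fin n → EuclideanSpace ℝ (Fin d) => gainDet σ α θ x := by
  have h : Continuous fun x : Fin n → EuclideanSpace ℝ (Fin d) =>
      1 + (α / σ ^ 2) • kernelMatrix θ x :=
    continuous_const.add (Continuous.fun_smul continuous_const (continuous_kernelMatrix θ))
  exact h.matrix_det

lemma continuous_ridgeGain (hl : 0 < σ ^ 2 / α) :
    Continuous fun p : (Fin n → EuclideanSpace ℝ (Fin d)) × (Fin n → ℝ) =>
      ridgeGain σ α θ p.1 p.2 :=
  (continuous_snd.dotProduct continuous_snd).sub (continuous_const.mul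
    (continuous_snd.dotProduct
      (((continuous_temperedInv θ hl).comp continuous_fst).matrix_mulVec continuous_snd)))

end Continuity

/-! ### The likelihood ratio process -/

section LikelihoodRatio

variable {d n : ℕ} {σ α : ℝ} (θ : Fin d → ℝ)

/-- The likelihood ratio of the noise vector `y` under `N(0, σ² I + α K)` and `N(0, σ² I)`. -/
def likRatio (σ α : ℝ) (θ : Fin d → ℝ) (x : Fin n → EuclideanSpace ℝ (Fin d)) (y : Fin n → ℝ) : ℝ :=
  (√(gainDet σ α θ x))⁻¹ * Real.exp (ridgeGain σ α θ x y / (2 * σ ^ 2))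

/-- The conditional likelihood ratio of a new noise `e`, with predictive mean `m` and rescaled
predictive variance `s`. -/
def stepRatio (σ α m s e : ℝ) : ℝ :=
  (√(1 + (σ ^ 2 / α)⁻¹ * s))⁻¹ *
    Real.exp ((e ^ 2 - σ ^ 2 / α * (e - m) ^ 2 / (σ ^ 2 / α + s)) / (2 * σ ^ 2))

lemma likRatio_nonneg (x : Fin n → EuclideanSpace ℝ (Fin d)) (y : Fin n → ℝ) :
    0 ≤ likRatio σ α θ x y := by
  unfold likRatio; positivity

lemma likRatio_snoc (hl : 0 < σ ^ 2 / α) (x : Fin (n + 1) → EuclideanSpace ℝ (Fin d))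
    (y : Fin n → ℝ) (e : ℝ) :
    likRatio σ α θ x (Fin.snoc y e : Fin (n + 1) → ℝ) = likRatio σ α θ (initPts x) y *
      stepRatio σ α (postMean σ α θ (initPts x) y (x (Fin.last n)))
        (postCov σ α θ (initPts x) (x (Fin.last n)) (x (Fin.last n))) e := by
  rw [likRatio, likRatio, stepRatio, ridgeGain_snoc θ x hl, gainDet_succ θ x hl,
    Real.sqrt_mul (gainDet_pos hl _ _).le, add_div, Real.exp_add, mul_inv]
  ring

/-- Multiplying by the density of N(0, σ²) gives the density of N(m, σ²(1 + s/l)), which has mass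
one. -/
lemma lintegral_stepRatio (hσ : 0 < σ) (hα : 0 < α) (m : ℝ) {s : ℝ} (hs : 0 ≤ s) :
    ∫⁻ e, ENNReal.ofReal (stepRatio σ α m s e) ∂(gaussianReal 0 (σ ^ 2).toNNReal) = 1 := by
  have hl : 0 < σ ^ 2 / α := by positivity
  have hv : (σ ^ 2).toNNReal ≠ 0 := by
    simp only [ne_eq, Real.toNNReal_eq_zero, not_le]; positivity
  have hw0 : 0 < σ ^ 2 * (1 + (σ ^ 2 / α)⁻¹ * s) := by positivity
  have hw : (σ ^ 2 * (1 + (σ ^ 2 / α)⁻¹ * s)).toNNReal ≠ 0 := by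
    simpa only [ne_eq, Real.toNNReal_eq_zero, not_le] using hw0
  rw [gaussianReal_of_var_ne_zero _ hv, lintegral_withDensity_eq_lintegral_mul₀
    (measurable_gaussianPDF _ _).aemeasurable
    (by unfold stepRatio; fun_prop), ← lintegral_gaussianPDF_eq_one m hw]
  refine lintegral_congr fun e => ?_
  rw [Pi.mul_apply, gaussianPDF, gaussianPDF, ← ENNReal.ofReal_mul (gaussianPDFReal_nonneg _ _ _)]
  congr 1
  rw [gaussianPDFReal, gaussianPDFReal, stepRatio, Real.coe_toNNReal _ (by positivity),
    Real.coe_toNNReal _ hw0.le, ← mul_assoc (2 * Real.pi), Real.sqrt_mul (by positivity) (1 + _),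
    mul_inv, sub_zero]
  rw [mul_mul_mul_comm, ← Real.exp_add]
  congr 2
  have h1 : σ ^ 2 / α + s ≠ 0 := by positivity
  have h2 : 1 + (σ ^ 2 / α)⁻¹ * s ≠ 0 := by positivity
  have h3 : σ ^ 2 / α + s = σ ^ 2 / α * (1 + (σ ^ 2 / α)⁻¹ * s) := by field_simp
  rw [h3]
  generalize (1 + (σ ^ 2 / α)⁻¹ * s) = c at h2 ⊢
  field_simp
  ring

variable {Ω : Type*} {mΩ : MeasurableSpace Ω} {X : Set (EuclideanSpace ℝ (Fin d))}

/-- The noises of the first `n` rounds. -/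
def noises (ε : ℕ → Ω → ℝ) (n : ℕ) (ω : Ω) : Fin n → ℝ := fun i => ε (i + 1) ω

lemma measurable_queries {m : MeasurableSpace Ω} {x : ℕ → Ω → X} {n : ℕ}
    (hx : ∀ i : Fin n, Measurable (x (i + 1))) : Measurable fun ω => queries x n ω :=
  measurable_pi_lambda _ fun i => measurable_subtype_coe.comp (hx i)

lemma measurable_noises {m : MeasurableSpace Ω} {ε : ℕ → Ω → ℝ} {n : ℕ}
    (hε : ∀ i : Fin n, Measurable (ε (i + 1))) : Measurable fun ω => noises ε n ω :=
  measurable_pi_lambda _ hε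

lemma measurable_likRatio (hl : 0 < σ ^ 2 / α) {m : MeasurableSpace Ω}
    {x : Ω → Fin n → EuclideanSpace ℝ (Fin d)} {y : Ω → Fin n → ℝ} (hx : Measurable x)
    (hy : Measurable y) : Measurable fun ω => likRatio σ α θ (x ω) (y ω) := by
  have h1 : Measurable fun ω => gainDet σ α θ (x ω) := (continuous_gainDet θ).measurable.comp hx
  have h2 : Measurable fun ω => ridgeGain σ α θ (x ω) (y ω) :=
    (continuous_ridgeGain θ hl).measurable.comp (hx.prodMk hy)
  exact h1.sqrt.inv.mul (h2.div_const _).exp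

lemma measurable_likRatio_state (hl : 0 < σ ^ 2 / α) {m : MeasurableSpace Ω}
    {x : Ω → Fin n → EuclideanSpace ℝ (Fin d)} {y : Ω → Fin n → ℝ}
    {z : Ω → EuclideanSpace ℝ (Fin d)} (hx : Measurable x) (hy : Measurable y)
    (hz : Measurable z) : Measurable fun ω => (likRatio σ α θ (x ω) (y ω),
      postMean σ α θ (x ω) (y ω) (z ω), postCov σ α θ (x ω) (z ω) (z ω)) := by
  refine (measurable_likRatio θ hl hx hy).prodMk (Measurable.prodMk ?_ ?_)
  · have h1 := (continuous_postMean (n := n) θ hl).measurable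
    have h2 := hx.prodMk (hy.prodMk hz)
    have h3 := h1.comp h2
    simpa only [Function.comp_def] using h3
  · have h1 := (continuous_postCov (n := n) θ hl).measurable
    have h3 := h1.comp (hx.prodMk hz)
    simpa only [Function.comp_def] using h3

/-- The likelihood ratio process has expectation one. -/
lemma lintegral_likRatio {P : Measure Ω} [IsProbabilityMeasure P] (hσ : 0 < σ) (hα : 0 < α)
    {ℱ : Filtration ℕ mΩ} {ε : ℕ → Ω → ℝ} {x : ℕ → Ω → X}
    (hε : ∀ t, 1 ≤ t → Measurable[ℱ t] (ε t))
    (hlaw : ∀ t, 1 ≤ t → HasLaw (ε t) (gaussianReal 0 (σ ^ 2).toNNReal) P)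
    (hind : ∀ t, 1 ≤ t → Indep (ℱ (t - 1)) (MeasurableSpace.comap (ε t) inferInstance) P)
    (hx : ∀ t, 1 ≤ t → Measurable[ℱ (t - 1)] (x t)) (n : ℕ) :
    ∫⁻ ω, ENNReal.ofReal (likRatio σ α θ (queries x n ω) (noises ε n ω)) ∂P = 1 := by
  have hl : 0 < σ ^ 2 / α := by positivity
  induction n with
  | zero => simp [likRatio, ridgeGain]
  | succ n ih =>
    have hq : ∀ ω, initPts (queries x (n + 1) ω) = queries x n ω := fun _ => rfl
    have hn : ∀ ω, noises ε (n + 1) ω =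
        (Fin.snoc (noises ε n ω) (ε (n + 1) ω) : Fin (n + 1) → ℝ) := by
      intro ω; funext i
      refine Fin.lastCases ?_ (fun i => ?_) i <;> simp [noises]
    -- All that the next ratio needs from the past; it is `ℱ n`-measurable because the query of
    -- round n + 1 is predictable, hence independent of the new noise.
    let W : Ω → ℝ × ℝ × ℝ := fun ω => (likRatio σ α θ (queries x n ω) (noises ε n ω),
      postMean σ α θ (queries x n ω) (noises ε n ω) (x (n + 1) ω),
      postCov σ α θ (queries x n ω) (x (n + 1) ω) (x (n + 1) ω))
    have hW : Measurable[ℱ n] W := measurable_likRatio_state θ hl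
      (measurable_queries fun i => (hx (i + 1) (by omega)).mono (ℱ.mono (by omega)) le_rfl)
      (measurable_noises fun i => (hε (i + 1) (by omega)).mono (ℱ.mono (by omega)) le_rfl)
      (measurable_subtype_coe.comp (hx (n + 1) (by omega)))
    have hWΩ : Measurable W := hW.mono (ℱ.le n) le_rfl
    have hεΩ : Measurable (ε (n + 1)) := (hε (n + 1) (by omega)).mono (ℱ.le _) le_rfl
    have hindW : IndepFun W (ε (n + 1)) P := by
      rw [IndepFun_iff_Indep]
      exact indep_of_indep_of_le_left (hind (n + 1) (by omega)) hW.comap_le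
    have hmap := (indepFun_iff_map_prod_eq_prod_map_map hWΩ.aemeasurable hεΩ.aemeasurable).1 hindW
    rw [(hlaw (n + 1) (by omega)).map_eq] at hmap
    -- The absolute value makes the variance argument nonnegative everywhere and changes nothing at
    -- `W ω`.
    let F : (ℝ × ℝ × ℝ) × ℝ → ENNReal := fun p =>
      ENNReal.ofReal (p.1.1 * stepRatio σ α p.1.2.1 |p.1.2.2| p.2)
    have hF : Measurable F := by
      unfold F stepRatio
      fun_prop
    have h1 : ∀ ω, ENNReal.ofReal (likRatio σ α θ (queries x (n + 1) ω) (noises ε (n + 1) ω)) =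
        F (W ω, ε (n + 1) ω) := by
      intro ω
      rw [hn, likRatio_snoc θ hl, hq]
      simp only [F, W]
      rw [abs_of_nonneg (postCov_nonneg _ _ _ hl)]
      rfl
    simp_rw [h1]
    rw [← lintegral_map (f := F) hF (hWΩ.prodMk hεΩ), hmap, lintegral_prod _ hF.aemeasurable,
      lintegral_map hF.lintegral_prod_right' hWΩ, ← ih]
    refine lintegral_congr fun ω => ?_
    simp only [F]
    have h2 : 0 ≤ (W ω).1 := likRatio_nonneg _ _ _
    simp_rw [ENNReal.ofReal_mul h2]
    rw [lintegral_const_mul _ (by unfold stepRatio; fun_prop),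
      lintegral_stepRatio hσ hα _ (abs_nonneg _), mul_one]

end LikelihoodRatio

/-! ### A finite net of length-scales -/

section Net

variable {d : ℕ}

/-- A point of the net of length-scales, equispaced in the precisions `θ⁻²`. -/
def netPoint (θL θU : Fin d → ℝ) (N : ℕ) (k : Fin d → Fin (N + 1)) : Fin d → ℝ := fun i =>
  (√((θU i ^ 2)⁻¹ + ((θL i ^ 2)⁻¹ - (θU i ^ 2)⁻¹) * ((k i : ℕ) / N)))⁻¹

lemma exists_grid_ge {a b c : ℝ} (hac : a ≤ c) (hcb : c ≤ b) {N : ℕ} (hN : 0 < N) :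
    ∃ k : Fin (N + 1), c ≤ a + (b - a) * ((k : ℕ) / N) ∧ a + (b - a) * ((k : ℕ) / N) ≤ b ∧
      a + (b - a) * ((k : ℕ) / N) ≤ c + (b - a) / N := by
  have hN' : (0 : ℝ) < N := by exact_mod_cast hN
  -- If a = b then r = 0, and `hrc` below remains true.
  set r := (c - a) / (b - a) with hr
  have hba : 0 ≤ b - a := by linarith
  have hr0 : 0 ≤ r := div_nonneg (by linarith) hba
  have hr1 : r ≤ 1 := div_le_one_of_le₀ (by linarith) hba
  have hrc : (b - a) * r = c - a := by
    rcases hba.eq_or_lt with h | h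
    · rw [← h]; linarith
    · rw [hr]; field_simp
  have hk : ⌈N * r⌉₊ ≤ N := Nat.ceil_le.2 (mul_le_of_le_one_right hN'.le hr1)
  refine ⟨⟨⌈N * r⌉₊, by omega⟩, ?_, ?_, ?_⟩ <;> simp only
  · have h1 : r ≤ (⌈N * r⌉₊ : ℝ) / N := by
      rw [le_div_iff₀ hN', mul_comm]; exact Nat.le_ceil _
    linarith [mul_le_mul_of_nonneg_left h1 hba]
  · have h1 : (⌈N * r⌉₊ : ℝ) / N ≤ 1 := by
      rw [div_le_one hN']; exact_mod_cast hk
    linarith [mul_le_mul_of_nonneg_left h1 hba]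
  · have h1 : (⌈N * r⌉₊ : ℝ) / N ≤ r + 1 / N := by
      rw [div_le_iff₀ hN', add_mul, one_div_mul_cancel hN'.ne', mul_comm r]
      exact (Nat.ceil_lt_add_one (by positivity)).le
    have h2 := mul_le_mul_of_nonneg_left h1 hba
    rw [mul_add, hrc, mul_one_div] at h2
    linarith

/-- Precisions are rounded up, so the net point lies below θ: in `gram_quadForm_le` the dominating
kernel is the one with smaller length-scales. -/
lemma exists_netPoint {θL θU θ : Fin d → ℝ} (hL : ∀ i, 0 < θL i) (hθL : ∀ i, θL i ≤ θ i)
    (hθU : ∀ i, θ i ≤ θU i) {N : ℕ} (hN : 0 < N) :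
    ∃ k, (∀ i, θL i ≤ netPoint θL θU N k i) ∧ (∀ i, netPoint θL θU N k i ≤ θ i) ∧
      ∀ i, |(netPoint θL θU N k i ^ 2)⁻¹ - (θ i ^ 2)⁻¹| ≤
        ((θL i ^ 2)⁻¹ - (θU i ^ 2)⁻¹) / N := by
  have h : ∀ i, ∃ k : Fin (N + 1),
      (θ i ^ 2)⁻¹ ≤ (θU i ^ 2)⁻¹ + ((θL i ^ 2)⁻¹ - (θU i ^ 2)⁻¹) * ((k : ℕ) / N) ∧
      (θU i ^ 2)⁻¹ + ((θL i ^ 2)⁻¹ - (θU i ^ 2)⁻¹) * ((k : ℕ) / N) ≤ (θL i ^ 2)⁻¹ ∧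
      (θU i ^ 2)⁻¹ + ((θL i ^ 2)⁻¹ - (θU i ^ 2)⁻¹) * ((k : ℕ) / N) ≤
        (θ i ^ 2)⁻¹ + ((θL i ^ 2)⁻¹ - (θU i ^ 2)⁻¹) / N := by
    intro i
    have h1 := hL i
    have h2 := hθL i
    have h3 := hθU i
    refine exists_grid_ge (inv_anti₀ (by nlinarith) ?_) (inv_anti₀ (by positivity) ?_) hN
    · exact pow_le_pow_left₀ (by linarith) h3 2
    · exact pow_le_pow_left₀ h1.le h2 2
  choose k hk1 hk2 hk3 using h
  have hpos : ∀ i, 0 < (θ i ^ 2)⁻¹ := fun i => by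
    have := (hL i).trans_le (hθL i)
    positivity
  refine ⟨k, fun i => ?_, fun i => ?_, fun i => ?_⟩ <;>
    simp only [netPoint] <;>
    set c := (θU i ^ 2)⁻¹ + ((θL i ^ 2)⁻¹ - (θU i ^ 2)⁻¹) * ((k i : ℕ) / N) <;>
    have hc := (hpos i).trans_le (hk1 i)
  · have h1 : √c ≤ (θL i)⁻¹ := by
      rw [Real.sqrt_le_left (inv_nonneg.2 (hL i).le), inv_pow]
      exact hk2 i
    calc θL i = ((θL i)⁻¹)⁻¹ := (inv_inv _).symm
      _ ≤ _ := inv_anti₀ (Real.sqrt_pos.2 hc) h1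
  · have h0 := (hL i).trans_le (hθL i)
    have h1 : (θ i)⁻¹ ≤ √c := by
      refine Real.le_sqrt_of_sq_le ?_
      rw [inv_pow]; exact hk1 i
    calc _ ≤ ((θ i)⁻¹)⁻¹ := inv_anti₀ (by positivity) h1
      _ = θ i := inv_inv _
  · rw [inv_pow, inv_inv, Real.sq_sqrt hc.le, abs_of_nonneg (by linarith [hk1 i])]
    linarith [hk3 i]

end Net

/-! ### Concentration of the posterior mean around the objective -/

section Concentration

variable {d : ℕ} {σ α : ℝ} {X : Set (EuclideanSpace ℝ (Fin d))} {Ω : Type*}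
  {mΩ : MeasurableSpace Ω}

/-- The threshold for the likelihood ratios after `n` rounds. -/
def likThreshold (d : ℕ) (δ : ℝ) (n : ℕ) : ℝ :=
  (((n + 1) ^ 2 + 1 : ℕ) : ℝ) ^ d * (Real.pi ^ 2 * ((n : ℝ) + 1) ^ 2 / (6 * δ))

lemma likThreshold_pos (d : ℕ) {δ : ℝ} (hδ : 0 < δ) (n : ℕ) : 0 < likThreshold d δ n := by
  have := Real.pi_pos
  unfold likThreshold
  positivity

/-- The Basel sum distributes the failure probability δ over the rounds. -/
lemma tsum_basel {δ : ℝ} (hδ : 0 < δ) :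
    ∑' n : ℕ, ENNReal.ofReal (6 * δ / (Real.pi ^ 2 * ((n : ℝ) + 1) ^ 2)) = ENNReal.ofReal δ := by
  have hpi := Real.pi_pos
  have h := (hasSum_nat_add_iff' 1).2 hasSum_zeta_two
  simp only [Finset.range_one, Finset.sum_singleton, Nat.cast_zero, ne_eq, OfNat.ofNat_ne_zero,
    not_false_eq_true, zero_pow, div_zero, sub_zero, Nat.cast_add, Nat.cast_one] at h
  have h2 := h.mul_left (6 * δ / Real.pi ^ 2)
  have h3 : 6 * δ / Real.pi ^ 2 * (Real.pi ^ 2 / 6) = δ := by field_simp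
  have h4 : ∀ n : ℕ, 6 * δ / Real.pi ^ 2 * (1 / ((n : ℝ) + 1) ^ 2) =
      6 * δ / (Real.pi ^ 2 * ((n : ℝ) + 1) ^ 2) := fun n => by field_simp
  simp_rw [h4, h3] at h2
  rw [← ENNReal.ofReal_tsum_of_nonneg (fun n => by positivity) h2.summable, h2.tsum_eq]

/-- With probability at least `1 - δ`, all likelihood ratios on the nets stay below their
thresholds. -/
lemma measure_exists_likThreshold_le {P : Measure Ω} [IsProbabilityMeasure P] (hσ : 0 < σ)
    (hα : 0 < α) {ℱ : Filtration ℕ mΩ} {ε : ℕ → Ω → ℝ} {x : ℕ → Ω → X}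
    (hε : ∀ t, 1 ≤ t → Measurable[ℱ t] (ε t))
    (hlaw : ∀ t, 1 ≤ t → HasLaw (ε t) (gaussianReal 0 (σ ^ 2).toNNReal) P)
    (hind : ∀ t, 1 ≤ t → Indep (ℱ (t - 1)) (MeasurableSpace.comap (ε t) inferInstance) P)
    (hx : ∀ t, 1 ≤ t → Measurable[ℱ (t - 1)] (x t)) {δ : ℝ} (hδ : 0 < δ) (θL θU : Fin d → ℝ) :
    P {ω | ∃ (n : ℕ) (k : Fin d → Fin ((n + 1) ^ 2 + 1)), likThreshold d δ n ≤
      likRatio σ α (netPoint θL θU ((n + 1) ^ 2) k) (queries x n ω) (noises ε n ω)} ≤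
      ENNReal.ofReal δ := by
  have hl : 0 < σ ^ 2 / α := by positivity
  simp only [Set.ofPred_exists]
  refine (measure_iUnion_le _).trans ?_
  rw [← tsum_basel hδ]
  refine ENNReal.tsum_le_tsum fun n => (measure_iUnion_le _).trans ?_
  rw [tsum_fintype]
  have hc := likThreshold_pos d hδ n
  have hpi := Real.pi_pos
  have key : ∀ k : Fin d → Fin ((n + 1) ^ 2 + 1), P {ω | likThreshold d δ n ≤
      likRatio σ α (netPoint θL θU ((n + 1) ^ 2) k) (queries x n ω) (noises ε n ω)} ≤
      ENNReal.ofReal (likThreshold d δ n)⁻¹ := by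
    intro k
    have hm : Measurable fun ω => likRatio σ α (netPoint θL θU ((n + 1) ^ 2) k)
        (queries x n ω) (noises ε n ω) := measurable_likRatio _ hl
      (measurable_queries fun i => (hx (i + 1) (by omega)).mono (ℱ.le _) le_rfl)
      (measurable_noises fun i => (hε (i + 1) (by omega)).mono (ℱ.le _) le_rfl)
    -- Markov's inequality; the expectation is one.
    have h1 := meas_ge_le_lintegral_div (μ := P) hm.ennreal_ofReal.aemeasurable
      (ε := ENNReal.ofReal (likThreshold d δ n)) (by simpa using hc) ENNReal.ofReal_ne_top
    rw [lintegral_likRatio _ hσ hα hε hlaw hind hx n, one_div, ← ENNReal.ofReal_inv_of_pos hc] at h1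
    refine le_trans (measure_mono fun ω hω => ?_) h1
    exact ENNReal.ofReal_le_ofReal hω
  refine (Finset.sum_le_sum fun k _ => key k).trans ?_
  -- The number of net points cancels the d-th power in `likThreshold`, leaving the Basel term.
  rw [Finset.sum_const, Finset.card_univ, Fintype.card_fun, Fintype.card_fin, Fintype.card_fin,
    nsmul_eq_mul, ← ENNReal.ofReal_natCast, ← ENNReal.ofReal_mul (by positivity)]
  refine ENNReal.ofReal_le_ofReal (le_of_eq ?_)
  rw [likThreshold, Nat.cast_pow]
  have : (((n + 1) ^ 2 + 1 : ℕ) : ℝ) ^ d ≠ 0 := by positivity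
  field_simp

/-- Each of the d factors (n+1)² + 1, and also the Basel factor, is at most the argument of the
logarithm in `mScale` at t = n + 1. -/
lemma log_likThreshold_le {δ : ℝ} (h0 : 0 < δ) (h1 : δ < 1) (n : ℕ) :
    Real.log (likThreshold d δ n) ≤
      (d + 1) * Real.log (2 * ((n + 1 : ℕ) : ℝ) ^ 2 * Real.pi ^ 2 / (3 * δ)) := by
  have hpi := Real.pi_gt_three
  have hn : (0 : ℝ) ≤ n := Nat.cast_nonneg n
  rw [likThreshold, Real.log_mul (by positivity) (by positivity), Real.log_pow, add_mul, one_mul]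
  push_cast
  refine add_le_add (mul_le_mul_of_nonneg_left (Real.log_le_log (by positivity) ?_)
    (Nat.cast_nonneg d)) (Real.log_le_log (by positivity) ?_)
  · rw [le_div_iff₀ (by positivity)]
    have h2 : (1 : ℝ) ≤ (n + 1) ^ 2 := by nlinarith
    have h3 : (9 : ℝ) ≤ Real.pi ^ 2 := by nlinarith
    nlinarith [mul_le_mul h2 h3 (by norm_num) (by positivity)]
  · rw [div_le_div_iff₀ (by positivity) (by positivity)]
    nlinarith [mul_nonneg (mul_nonneg (sq_nonneg Real.pi) (sq_nonneg ((n : ℝ) + 1))) h0.le]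

lemma ridgeGain_le_of_likRatio_lt (hσ : 0 < σ) (hα : 0 < α) {θ : Fin d → ℝ} {n : ℕ}
    {x : Fin n → EuclideanSpace ℝ (Fin d)} {y : Fin n → ℝ} {c : ℝ}
    (h : likRatio σ α θ x y < c) :
    ridgeGain σ α θ x y ≤ 2 * σ ^ 2 * (1 / 2 * Real.log (gainDet σ α θ x) + Real.log c) := by
  have hl : 0 < σ ^ 2 / α := by positivity
  have hD := gainDet_pos hl θ x
  have h1 : 0 < likRatio σ α θ x y := by unfold likRatio; positivity
  have h2 := Real.log_le_log h1 h.le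
  rw [likRatio, Real.log_mul (by positivity) (by positivity), Real.log_exp, Real.log_inv,
    Real.log_sqrt hD.le] at h2
  have h3 : ridgeGain σ α θ x y / (2 * σ ^ 2) ≤
      1 / 2 * Real.log (gainDet σ α θ x) + Real.log c := by linarith
  rwa [div_le_iff₀' (by positivity)] at h3

lemma prod_div_le {θL θU a b : Fin d → ℝ} (hL : ∀ i, 0 < θL i) (hb : ∀ i, θL i ≤ b i)
    (ha : ∀ i, a i ≤ θU i) (ha0 : ∀ i, 0 ≤ a i) : ∏ i, a i / b i ≤ ∏ i, θU i / θL i := by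
  refine Finset.prod_le_prod (fun i _ => ?_) fun i _ => ?_
  · exact div_nonneg (ha0 i) ((hL i).le.trans (hb i))
  · exact div_le_div₀ ((ha0 i).trans (ha i)) (ha i) (hL i) (hb i)

lemma one_le_prod_div {θL θU : Fin d → ℝ} (hL : ∀ i, 0 < θL i) (hLU : ∀ i, θL i ≤ θU i) :
    1 ≤ ∏ i, θU i / θL i :=
  (Finset.prod_const_one (s := Finset.univ)).symm.le.trans
    (Finset.prod_le_prod (fun _ _ => zero_le_one) fun i _ => (one_le_div (hL i)).2 (hLU i))

lemma quadForm_gram_nonneg {ι : Type*} [Fintype ι] (θ : Fin d → ℝ)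
    (x : ι → EuclideanSpace ℝ (Fin d)) (v : ι → ℝ) : 0 ≤ v ⬝ᵥ gram θ x *ᵥ v := by
  simpa using (posSemidef_gram θ x).dotProduct_mulVec_nonneg v

/-- The bias of the posterior mean with misspecified length-scales. -/
lemma abs_sub_postWeights_le (hl : 0 < σ ^ 2 / α) {θL θU θ : Fin d → ℝ} (hL : ∀ i, 0 < θL i)
    (hθL : ∀ i, θL i ≤ θ i) (hθU : ∀ i, θ i ≤ θU i)
    {H : Type*} [NormedAddCommGroup H] [InnerProductSpace ℝ H] [CompleteSpace H] [RKHS ℝ H X ℝ]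
    (hH : ∀ x y : X, RKHS.kernel H x y (1 : ℝ) = seKernel θU x y) (f : H) {n : ℕ}
    (x : Fin n → X) (z : X) :
    |f z - postWeights θ (fun i => (x i : EuclideanSpace ℝ (Fin d))) z σ α ⬝ᵥ fun i => f (x i)| ≤
      √(∏ i, θU i / θL i) * ‖f‖ *
        postStd σ α θ (fun i => (x i : EuclideanSpace ℝ (Fin d))) z := by
  set xs : Fin n → EuclideanSpace ℝ (Fin d) := fun i => x i
  set w := postWeights θ xs z σ α
  let p : Fin n ⊕ Fin 1 → X := Sum.elim x fun _ => z
  have hp : ∀ i, (p i : EuclideanSpace ℝ (Fin d)) = extend xs z i := by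
    rintro (i | i) <;> rfl
  set v := extendCoeff w
  -- The representer of f ↦ f(z) - ∑ wᵢ f(xᵢ); its squared norm is the residual for θU, although w
  -- is optimal for θ.
  let F : H := ∑ i, v i • RKHS.kerFun H (p i) (1 : ℝ)
  have h1 : f z - w ⬝ᵥ (fun i => f (x i)) = inner ℝ f F := by
    simp only [F, inner_sum, inner_smul_right, RKHS.inner_kerFun]
    simp [v, extendCoeff, p, dotProduct]
    ring
  have h2 : ‖F‖ ^ 2 = residual θU xs z w := by
    rw [residual_eq_quadForm, dotProduct_gram_mulVec, ← real_inner_self_eq_norm_sq]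
    simp only [F, sum_inner, inner_sum, inner_smul_left, inner_smul_right]
    refine Finset.sum_congr rfl fun i _ => ?_
    rw [Finset.mul_sum]
    refine Finset.sum_congr rfl fun j _ => ?_
    have h3 := RKHS.kernel_inner H (p i) (p j) (1 : ℝ) (1 : ℝ)
    rw [hH] at h3
    rw [← h3, ← hp, ← hp]
    simp only [v, conj_trivial, RCLike.inner_apply, one_mul]
    ring
  have hs := postCov_nonneg θ xs z hl
  have h3 : ‖F‖ ^ 2 ≤ (∏ i, θU i / θL i) * postCov σ α θ xs z z := by
    rw [h2, residual_eq_quadForm]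
    refine (gram_quadForm_le (fun i => (hL i).trans_le (hθL i)) hθU _ _).trans ?_
    rw [← residual_eq_quadForm]
    refine mul_le_mul (prod_div_le hL hθL (fun _ => le_rfl) fun i =>
      ((hL i).trans_le ((hθL i).trans (hθU i))).le) (residual_postWeights_le θ xs z hl)
      (residual_nonneg _ _ _ _) ?_
    exact zero_le_one.trans (one_le_prod_div hL fun i => (hθL i).trans (hθU i))
  rw [h1]
  refine (abs_real_inner_le_norm f F).trans ?_
  have h4 : ‖F‖ ≤ √(∏ i, θU i / θL i) * postStd σ α θ xs z := by
    rw [postStd, ← Real.sqrt_mul (zero_le_one.trans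
      (one_le_prod_div hL fun i => (hθL i).trans (hθU i)))]
    exact Real.le_sqrt_of_sq_le h3
  calc ‖f‖ * ‖F‖ ≤ ‖f‖ * (√(∏ i, θU i / θL i) * postStd σ α θ xs z) := by gcongr
    _ = _ := by ring

/-- The constant in the bound of the noise part of the posterior mean. -/
def noiseConst (σ α D : ℝ) (θL θU : Fin d → ℝ) : ℝ :=
  2 * (∏ i, θU i / θL i) * (d + 1 +
    (σ ^ 2 / α)⁻¹ * (1 + (σ ^ 2 / α)⁻¹) * (D ^ 2 * ∑ i, ((θL i ^ 2)⁻¹ - (θU i ^ 2)⁻¹)))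

lemma inv_sq_sub_nonneg {θL θU : Fin d → ℝ} (hL : ∀ i, 0 < θL i) (hLU : ∀ i, θL i ≤ θU i)
    (i : Fin d) : 0 ≤ (θL i ^ 2)⁻¹ - (θU i ^ 2)⁻¹ := by
  have h1 := hL i
  have h2 := hLU i
  have : (θU i ^ 2)⁻¹ ≤ (θL i ^ 2)⁻¹ :=
    inv_anti₀ (by positivity) (pow_le_pow_left₀ h1.le h2 2)
  linarith

lemma noiseConst_nonneg (hl : 0 < σ ^ 2 / α) (D : ℝ) {θL θU : Fin d → ℝ} (hL : ∀ i, 0 < θL i)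
    (hLU : ∀ i, θL i ≤ θU i) : 0 ≤ noiseConst σ α D θL θU := by
  have h1 := one_le_prod_div hL hLU
  have h2 : 0 ≤ ∑ i, ((θL i ^ 2)⁻¹ - (θU i ^ 2)⁻¹) :=
    Finset.sum_nonneg fun i _ => inv_sq_sub_nonneg hL hLU i
  have h3 := inv_pos.2 hl
  unfold noiseConst
  positivity

/-- The noise part of the posterior mean, on the event that the likelihood ratios stay below their
thresholds. -/
lemma abs_postMean_noise_le (hσ : 0 < σ) (hα : 0 < α) {D : ℝ}
    (hD : ∀ y ∈ X, ∀ z ∈ X, dist y z ≤ D) {θL θU θ : Fin d → ℝ} (hL : ∀ i, 0 < θL i)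
    (hθL : ∀ i, θL i ≤ θ i) (hθU : ∀ i, θ i ≤ θU i) {δ : ℝ} (h0 : 0 < δ) (h1 : δ < 1) {n : ℕ}
    {x : Fin n → EuclideanSpace ℝ (Fin d)} (hx : ∀ i, x i ∈ X) {e : Fin n → ℝ}
    (h : ∀ k, likRatio σ α (netPoint θL θU ((n + 1) ^ 2) k) x e < likThreshold d δ n)
    {z : EuclideanSpace ℝ (Fin d)} (hz : z ∈ X) :
    |postMean σ α θ x e z| ≤
      √(noiseConst σ α D θL θU) * mScale X σ α δ θ (n + 1) * postStd σ α θ x z := by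
  have hl : 0 < σ ^ 2 / α := by positivity
  have : Nonempty X := ⟨⟨z, hz⟩⟩
  have hLU := fun i => (hθL i).trans (hθU i)
  -- At resolution (n+1)², the log-determinant error, n² times the kernel error of order (n+1)⁻²,
  -- stays bounded (`hc1`).
  obtain ⟨k, hk1, hk2, hk3⟩ := exists_netPoint hL hθL hθU (N := (n + 1) ^ 2) (by positivity)
  set θ' := netPoint θL θU ((n + 1) ^ 2) k
  set C₂ := ∏ i, θU i / θL i with hC₂
  have hC1 : 1 ≤ C₂ := one_le_prod_div hL hLU
  have hθ'pos : ∀ i, 0 < θ' i := fun i => (hL i).trans_le (hk1 i)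
  have hr1 : ridgeGain σ α θ x e ≤ C₂ * ridgeGain σ α θ' x e := by
    refine ridgeGain_le_mul x hl hC1 (fun v => ?_) e
    refine (gram_quadForm_le hθ'pos hk2 x v).trans ?_
    exact mul_le_mul_of_nonneg_right (prod_div_le hL hk1 hθU fun i =>
      (hL i).le.trans (hθL i)) (quadForm_gram_nonneg θ' x v)
  have hr2 := ridgeGain_le_of_likRatio_lt hσ hα (h k)
  have hlog := log_likThreshold_le (d := d) h0 h1 n
  set L := Real.log (2 * ((n + 1 : ℕ) : ℝ) ^ 2 * Real.pi ^ 2 / (3 * δ)) with hL'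
  have hL1 : 1 ≤ L := one_le_log_mScale h0 h1 (by omega)
  set S := ∑ i, ((θL i ^ 2)⁻¹ - (θU i ^ 2)⁻¹) with hS
  have hS0 : 0 ≤ S := Finset.sum_nonneg fun i _ => inv_sq_sub_nonneg hL hLU i
  have hli := inv_pos.2 hl
  have hη : ∀ y ∈ X, ∀ z ∈ X, |seKernel θ' y z - seKernel θ y z| ≤
      D ^ 2 * S / (((n + 1) ^ 2 : ℕ) : ℝ) := by
    intro y hy z hz
    refine (abs_seKernel_sub_le θ' θ y z).trans ?_
    have h2 : ∑ i, (y i - z i) ^ 2 * |(θ' i ^ 2)⁻¹ - (θ i ^ 2)⁻¹| ≤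
        ∑ i, D ^ 2 * (((θL i ^ 2)⁻¹ - (θU i ^ 2)⁻¹) / (((n + 1) ^ 2 : ℕ) : ℝ)) := by
      refine Finset.sum_le_sum fun i _ => ?_
      refine mul_le_mul ?_ (hk3 i) (abs_nonneg _) (sq_nonneg _)
      have h3 : |y i - z i| ≤ dist y z := by
        rw [dist_eq_norm]
        exact PiLp.norm_apply_le (y - z) i
      rw [← sq_abs]
      exact pow_le_pow_left₀ (abs_nonneg _) (h3.trans (hD y hy z hz)) 2
    rw [← Finset.mul_sum, ← Finset.sum_div, ← hS, mul_div_assoc'] at h2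
    have h4 : 0 ≤ D ^ 2 * S / (((n + 1) ^ 2 : ℕ) : ℝ) := by positivity
    linarith
  have hlogD := log_gainDet_le_add hl (by positivity) hη n le_rfl x hx
  have hγ := half_log_gainDet_le hl θ x hx
  have hγ0 := infoGain_nonneg (X := X) hl θ n
  set γ := infoGain X σ α θ n with hγdef
  set q := (σ ^ 2 / α)⁻¹ with hq
  have hc1 : n * (q * (D ^ 2 * S / (((n + 1) ^ 2 : ℕ) : ℝ) * (n * (1 + q)))) ≤
      q * (1 + q) * (D ^ 2 * S) := by
    have h2 : (n : ℝ) * n / (((n + 1) ^ 2 : ℕ) : ℝ) ≤ 1 := by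
      rw [div_le_one (by positivity)]
      push_cast
      nlinarith [(Nat.cast_nonneg n : (0 : ℝ) ≤ n)]
    calc _ = q * (1 + q) * (D ^ 2 * S) * (n * n / (((n + 1) ^ 2 : ℕ) : ℝ)) := by ring
      _ ≤ _ := mul_le_of_le_one_right (by positivity) h2
  set c := q * (1 + q) * (D ^ 2 * S) with hc
  have hc0 : 0 ≤ c := by positivity
  have hr3 : ridgeGain σ α θ x e ≤ C₂ * (2 * σ ^ 2 * ((d + 1 + c) * (√γ + √L) ^ 2)) := by
    refine hr1.trans (mul_le_mul_of_nonneg_left (hr2.trans ?_) (by linarith))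
    refine mul_le_mul_of_nonneg_left ?_ (by positivity)
    have h2 : γ + L ≤ (√γ + √L) ^ 2 := by
      have h3 := Real.sq_sqrt hγ0
      have h4 := Real.sq_sqrt (zero_le_one.trans hL1)
      nlinarith [mul_nonneg (Real.sqrt_nonneg γ) (Real.sqrt_nonneg L)]
    have hd : (0 : ℝ) ≤ d := Nat.cast_nonneg d
    have h3 : 0 ≤ (d + 1 + c : ℝ) := by linarith
    refine le_trans ?_ (mul_le_mul_of_nonneg_left h2 h3)
    nlinarith [mul_nonneg hd hγ0, mul_nonneg hc0 hγ0, mul_le_mul_of_nonneg_left hL1 hc0]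
  have hm := postMean_sq_le θ x z hl e
  have hs := postCov_nonneg θ x z hl
  refine abs_le_of_sq_le_sq ?_ ?_
  · refine hm.trans ?_
    rw [mul_pow, mul_pow, postStd, Real.sq_sqrt hs, Real.sq_sqrt (noiseConst_nonneg hl D hL hLU),
      mScale, mul_pow, Real.sq_sqrt hα.le, Nat.add_sub_cancel, mul_comm]
    refine mul_le_mul_of_nonneg_right ?_ hs
    calc q * ridgeGain σ α θ x e ≤ q * (C₂ * (2 * σ ^ 2 * ((d + 1 + c) * (√γ + √L) ^ 2))) := by
          gcongr
      -- The product (σ²/α)⁻¹ · 2σ² = 2α supplies the factor √α of `mScale`.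
      _ = _ := by
          rw [noiseConst, ← hS, ← hC₂, ← hq, ← hc, hq, inv_div, ← hγdef, ← hL']
          field_simp
  · have := (Real.sqrt_nonneg α).trans (sqrt_le_mScale (X := X) (σ := σ) (α := α) h0 h1 θ
      (show 1 ≤ n + 1 by omega))
    unfold postStd
    positivity

end Concentration

/-! ### Instantaneous regret and summation -/

section Regret

variable {d : ℕ} {X : Set (EuclideanSpace ℝ (Fin d))} {σ α g : ℝ}

lemma varRatio_pos (hσ : 0 < σ) (hα : 0 < α) {T : ℕ} (hT : 1 ≤ T) : 0 < varRatio σ α T := by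
  have hT' : (0 : ℝ) ≤ T - 1 := by
    have : (1 : ℝ) ≤ T := by exact_mod_cast hT
    linarith
  unfold varRatio
  positivity

lemma varRatio_anti (hσ : 0 < σ) (hα : 0 < α) {t T : ℕ} (ht : 1 ≤ t) (hT : t ≤ T) :
    varRatio σ α T ≤ varRatio σ α t := by
  have ht' : (0 : ℝ) ≤ t - 1 := by
    have : (1 : ℝ) ≤ t := by exact_mod_cast ht
    linarith
  unfold varRatio
  gcongr

lemma varRatio_le_one (hσ : 0 < σ) (hα : 0 < α) {T : ℕ} (hT : 1 ≤ T) : varRatio σ α T ≤ 1 := by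
  refine (varRatio_anti hσ hα le_rfl hT).trans_eq ?_
  have : σ ^ 2 ≠ 0 := by positivity
  simp [varRatio, this]

lemma varRatio_succ (hσ : 0 < σ) (hα : 0 < α) (n : ℕ) :
    varRatio σ α (n + 1) = σ ^ 2 / α / (n + σ ^ 2 / α) := by
  have h : α * n + σ ^ 2 ≠ 0 := by positivity
  rw [varRatio]
  push_cast
  field_simp
  simpa using h

/-- The argument of `τ_g⁻¹` in the regret bound. -/
def tauArg (σ α g : ℝ) (T : ℕ) : ℝ := gConst g * varRatio σ α T ^ (g / 2)

lemma tauArg_pos (hσ : 0 < σ) (hα : 0 < α) (hg : 0 ≤ g) {T : ℕ} (hT : 1 ≤ T) :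
    0 < tauArg σ α g T :=
  mul_pos (gConst_pos hg) (Real.rpow_pos_of_pos (varRatio_pos hσ hα hT) _)

lemma tauArg_le (hσ : 0 < σ) (hα : 0 < α) (hg : 0 ≤ g) {T : ℕ} (hT : 1 ≤ T) :
    tauArg σ α g T ≤ gConst g :=
  mul_le_of_le_one_right (gConst_pos hg).le
    (Real.rpow_le_one (varRatio_pos hσ hα hT).le (varRatio_le_one hσ hα hT) (by positivity))

lemma tauInv_tauArg_mono (hσ : 0 < σ) (hα : 0 < α) (hg : 0 ≤ g) {t T : ℕ} (ht : 1 ≤ t)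
    (hT : t ≤ T) : tauInv g (tauArg σ α g t) ≤ tauInv g (tauArg σ α g T) := by
  refine le_tauInv hg (tauArg_pos hσ hα hg (ht.trans hT)) (tauArg_le hσ hα hg (ht.trans hT)) ?_
  rw [tau_tauInv hg (tauArg_pos hσ hα hg ht) (tauArg_le hσ hα hg ht)]
  have h1 := varRatio_anti hσ hα ht hT
  have h2 := varRatio_pos hσ hα (ht.trans hT)
  have h3 := gConst_pos hg
  unfold tauArg
  gcongr

/-- The instantaneous regret of a maximizer of the acquisition function. -/
lemma instant_regret_le (hX : IsCompact X) (hσ : 0 < σ) (hα : 0 < α) (hg : 0 < g)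
    {θ : Fin d → ℝ} {n : ℕ} {x : Fin n → EuclideanSpace ℝ (Fin d)} {y : Fin n → ℝ} {ν b ρ : ℝ}
    (hν : 0 < ν) (hb : 0 ≤ b) (hbρ : b ≤ ρ * ν) {f : X → ℝ}
    (hf : ∀ z : X, |f z - postMean σ α θ x y z| ≤ b * postStd σ α θ x z) (xstar xt : X)
    (hmax : ∀ z : X, acquisition X σ α g ν θ x y z ≤ acquisition X σ α g ν θ x y xt) :
    f xstar - f xt ≤ (b * ((gConst g / tau g ρ) ^ (1 / g) + 1) +
      ν * tauInv g (tauArg σ α g (n + 1))) * postStd σ α θ x xt := by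
  have hl : 0 < σ ^ 2 / α := by positivity
  have hcont : ContinuousOn (postMean σ α θ x y) X := by
    have h1 := (continuous_postMean (n := n) θ hl).comp
      ((continuous_const (y := x)).prodMk ((continuous_const (y := y)).prodMk continuous_id))
    simp only [Function.comp_def, id_eq] at h1
    exact h1.continuousOn
  -- A point attaining μ⁺, where the argument of τ_g is 0; comparing x_t with it bounds `v xt`.
  obtain ⟨zp, hzp, hzp'⟩ := hX.exists_sSup_image_eq ⟨xt, xt.2⟩ hcont
  have hle : ∀ z : X, postMean σ α θ x y z ≤ maxPostMean X σ α θ x y := fun z =>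
    le_csSup (hX.bddAbove_image hcont) ⟨z, z.2, rfl⟩
  have hspos : ∀ z, 0 < postStd σ α θ x z := fun z => Real.sqrt_pos.2 (postCov_pos θ x z hl)
  set μp := maxPostMean X σ α θ x y with hμp
  set μ := postMean σ α θ x y
  set s := postStd σ α θ x
  set v : EuclideanSpace ℝ (Fin d) → ℝ := fun z => (μp - μ z) / s z / ν with hv
  have hvmul : ∀ z, μp - μ z = ν * s z * v z := by
    intro z
    have := (hspos z).ne'
    simp only [hv]
    field_simp
  have hv0 : ∀ z : X, 0 ≤ v z := fun z =>
    div_nonneg (div_nonneg (by linarith [hle z]) (hspos z).le) hν.le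
  have hcmp : ∀ z : X, s z ^ g * tau g (v z) ≤ s xt ^ g * tau g (v xt) := by
    intro z
    have h := hmax z
    rw [acquisition, acquisition, mul_assoc, mul_assoc] at h
    exact le_of_mul_le_mul_left h (Real.rpow_pos_of_pos hν g)
  have hst1 : s xt ^ g ≤ 1 := by
    refine Real.rpow_le_one (hspos _).le ?_ hg.le
    exact Real.sqrt_le_one.2 (postCov_le_one θ x _ hl)
  have hvt : v xt ≤ tauInv g (tauArg σ α g (n + 1)) := by
    refine le_tauInv hg.le (tauArg_pos hσ hα hg.le (by omega))
      (tauArg_le hσ hα hg.le (by omega)) ?_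
    have h1 := hcmp ⟨zp, hzp⟩
    have h2 : v zp = 0 := by
      have h3 : μp = μ zp := hzp'
      simp [hv, h3]
    simp only [h2, tau_zero hg.le] at h1
    have h3 : varRatio σ α (n + 1) ^ (g / 2) ≤ s zp ^ g := by
      rw [varRatio_succ hσ hα]
      have h4 := le_postCov θ x zp hl
      have h5 : s zp ^ g = postCov σ α θ x zp zp ^ (g / 2) := by
        simp only [s, postStd]
        rw [Real.sqrt_eq_rpow, ← Real.rpow_mul (postCov_nonneg θ x zp hl)]
        congr 1; ring
      rw [h5]
      exact Real.rpow_le_rpow (by positivity) h4 (by positivity)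
    calc tauArg σ α g (n + 1) ≤ gConst g * s zp ^ g :=
          mul_le_mul_of_nonneg_left h3 (gConst_pos hg.le).le
      _ = s zp ^ g * gConst g := mul_comm _ _
      _ ≤ s xt ^ g * tau g (v xt) := h1
      _ ≤ tau g (v xt) := mul_le_of_le_one_left (tau_pos hg.le _).le hst1
  -- The bound on σ(x⋆)/σ(x_t) when `v xstar ≤ ρ`: then σ(x⋆)^g τ_g(ρ) ≤ σ(x_t)^g τ_g(0).
  set K := (gConst g / tau g ρ) ^ (1 / g) with hK
  have hτρ := tau_pos hg.le ρ
  have hG := gConst_pos hg.le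
  have hK0 : 0 ≤ K := Real.rpow_nonneg (by positivity) _
  have hfirst : f xstar - μp ≤ b * K * s xt := by
    have h1 := (abs_le.1 (hf xstar)).2
    rcases le_or_gt (v xstar) ρ with hc | hc
    · have h2 : s xstar ≤ K * s xt := by
        have h3 : s xstar ^ g ≤ (K * s xt) ^ g := by
          rw [Real.mul_rpow hK0 (hspos _).le, hK, ← Real.rpow_mul (by positivity),
            one_div_mul_cancel hg.ne', Real.rpow_one, div_mul_eq_mul_div, le_div_iff₀ hτρ]
          have h5 := Real.rpow_nonneg (hspos xstar).le g
          have h6 := Real.rpow_nonneg (hspos xt).le g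
          calc s xstar ^ g * tau g ρ ≤ s xstar ^ g * tau g (v xstar) :=
                mul_le_mul_of_nonneg_left ((strictAnti_tau hg.le).antitone hc) h5
            _ ≤ s xt ^ g * tau g (v xt) := hcmp xstar
            _ ≤ s xt ^ g * tau g 0 :=
                mul_le_mul_of_nonneg_left ((strictAnti_tau hg.le).antitone (hv0 xt)) h6
            _ = gConst g * s xt ^ g := by rw [tau_zero hg.le, mul_comm]
        exact (Real.rpow_le_rpow_iff (hspos _).le (mul_nonneg hK0 (hspos _).le) hg).1 h3
      have h4 := mul_le_mul_of_nonneg_left h2 hb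
      linarith [hle xstar]
    -- Here the gap at x⋆ exceeds ρνσ(x⋆), hence the confidence width, so f(x⋆) ≤ μ⁺.
    · have h2 : b * s xstar ≤ μp - μ xstar := by
        rw [hvmul]
        calc b * s xstar ≤ ρ * ν * s xstar := mul_le_mul_of_nonneg_right hbρ (hspos _).le
          _ = ν * s xstar * ρ := by ring
          _ ≤ ν * s xstar * v xstar :=
              mul_le_mul_of_nonneg_left hc.le (mul_nonneg hν.le (hspos _).le)
      have h3 : 0 ≤ b * K * s xt := mul_nonneg (mul_nonneg hb hK0) (hspos _).le
      linarith
  have hsecond : μp - μ xt ≤ ν * s xt * tauInv g (tauArg σ α g (n + 1)) := by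
    rw [hvmul]
    exact mul_le_mul_of_nonneg_left hvt (mul_nonneg hν.le (hspos _).le)
  have hthird := (abs_le.1 (hf xt)).1
  linarith

lemma sum_Icc_one_eq (F : ℕ → ℝ) (T : ℕ) :
    ∑ t ∈ Finset.Icc 1 T, F t = ∑ t ∈ Finset.range T, F (t + 1) := by
  induction T with
  | zero => simp
  | succ T ih => rw [Finset.sum_Icc_succ_top (by omega), ih, Finset.sum_range_succ]

/-- The posterior standard deviations of the queries sum up to at most `√(T γ_T)`, up to constants. -/
lemma sum_postStd_le [Nonempty X] (hl : 0 < σ ^ 2 / α) (θ : Fin d → ℝ) {Ω : Type*} (x : ℕ → Ω → X)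
    (T : ℕ) (ω : Ω) :
    ∑ t ∈ Finset.Icc 1 T, postStd σ α θ (queries x (t - 1) ω) (x t ω) ≤
      √(2 * (σ ^ 2 / α + 1) * (infoGain X σ α θ T * T)) := by
  rw [sum_Icc_one_eq]
  -- Cauchy–Schwarz reduces to the sum of the variances.
  refine Real.le_sqrt_of_sq_le (sq_sum_le_card_mul_sum_sq.trans ?_)
  have h1 := sum_postCov_le hl θ (fun i => (x (i + 1) ω : EuclideanSpace ℝ (Fin d))) T
  have h2 := half_log_gainDet_le (X := X) hl θ
    (fun i : Fin T => (x (i + 1) ω : EuclideanSpace ℝ (Fin d))) fun i => (x _ ω).2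
  have h3 : ∑ t ∈ Finset.range T, postStd σ α θ (queries x (t + 1 - 1) ω) (x (t + 1) ω) ^ 2 ≤
      2 * (σ ^ 2 / α + 1) * infoGain X σ α θ T := by
    refine (Finset.sum_congr rfl fun t _ => ?_).trans_le (h1.trans ?_)
    · rw [postStd, Real.sq_sqrt (postCov_nonneg _ _ _ hl)]
      rfl
    · have := mul_le_mul_of_nonneg_left h2 (show 0 ≤ 2 * (σ ^ 2 / α + 1) by linarith)
      linarith
  rw [Finset.card_range]
  calc _ ≤ (T : ℝ) * (2 * (σ ^ 2 / α + 1) * infoGain X σ α θ T) := by gcongr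
    _ = _ := by ring

end Regret

/-! ### Cumulative regret -/

section Main

variable {d : ℕ} {X : Set (EuclideanSpace ℝ (Fin d))} {σ α g : ℝ}

/-- The posterior means are uniformly close to the objective when the likelihood ratios stay below
their thresholds. -/
lemma abs_sub_postMean_le (hσ : 0 < σ) (hα : 0 < α) {D : ℝ}
    (hD : ∀ y ∈ X, ∀ z ∈ X, dist y z ≤ D) {θL θU θ : Fin d → ℝ} (hL : ∀ i, 0 < θL i)
    (hθL : ∀ i, θL i ≤ θ i) (hθU : ∀ i, θ i ≤ θU i) {δ : ℝ} (h0 : 0 < δ) (h1 : δ < 1)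
    {H : Type*} [NormedAddCommGroup H] [InnerProductSpace ℝ H] [CompleteSpace H] [RKHS ℝ H X ℝ]
    (hH : ∀ x y : X, RKHS.kernel H x y (1 : ℝ) = seKernel θU x y) {f : H} {B : ℝ} (hB : ‖f‖ ≤ B)
    {Ω : Type*} {x : ℕ → Ω → X} {ε : ℕ → Ω → ℝ} {ω : Ω} {n : ℕ}
    (h : ∀ k, likRatio σ α (netPoint θL θU ((n + 1) ^ 2) k) (queries x n ω) (noises ε n ω) <
      likThreshold d δ n) (z : X) :
    |f z - postMean σ α θ (queries x n ω) (responses (fun z : X => f z) x ε n ω) z| ≤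
      (√(noiseConst σ α D θL θU) + √(∏ i, θU i / θL i) * B / √α) * mScale X σ α δ θ (n + 1) *
        postStd σ α θ (queries x n ω) z := by
  have hl : 0 < σ ^ 2 / α := by positivity
  have hnoise := abs_postMean_noise_le hσ hα hD hL hθL hθU h0 h1
    (x := queries x n ω) (fun i => (x (i + 1) ω).2) h z.2
  have hbias := abs_sub_postWeights_le hl hL hθL hθU hH f (fun i : Fin n => x (i + 1) ω) z
  have hm := sqrt_le_mScale (X := X) (σ := σ) (α := α) h0 h1 θ (show 1 ≤ n + 1 by omega)
  have hα' := Real.sqrt_pos.2 hα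
  have hB0 : 0 ≤ B := (norm_nonneg f).trans hB
  have hs : 0 ≤ postStd σ α θ (queries x n ω) z := Real.sqrt_nonneg _
  have hsplit : postMean σ α θ (queries x n ω) (responses (fun z : X => f z) x ε n ω) z =
      (postWeights θ (queries x n ω) z σ α ⬝ᵥ fun i : Fin n => f (x (i + 1) ω)) +
        postMean σ α θ (queries x n ω) (noises ε n ω) z := by
    rw [postMean_eq _ _ _ hl, postMean_eq _ _ _ hl, ← dotProduct_add]
    rfl
  have hbias2 : √(∏ i, θU i / θL i) * ‖f‖ * postStd σ α θ (queries x n ω) z ≤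
      √(∏ i, θU i / θL i) * B / √α * mScale X σ α δ θ (n + 1) *
        postStd σ α θ (queries x n ω) z := by
    refine mul_le_mul_of_nonneg_right ?_ hs
    calc √(∏ i, θU i / θL i) * ‖f‖ ≤ √(∏ i, θU i / θL i) * B := by gcongr
      _ = √(∏ i, θU i / θL i) * B / √α * √α := by field_simp
      _ ≤ _ := mul_le_mul_of_nonneg_left hm (by positivity)
  have hbias' : |f z - (postWeights θ (queries x n ω) z σ α ⬝ᵥ fun i : Fin n => f (x (i + 1) ω))| ≤
      √(∏ i, θU i / θL i) * ‖f‖ * postStd σ α θ (queries x n ω) z := hbias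
  rw [hsplit, ← sub_sub]
  refine (abs_sub _ _).trans ?_
  linarith

lemma abs_apply_le_norm {θU : Fin d → ℝ} {H : Type*} [NormedAddCommGroup H]
    [InnerProductSpace ℝ H] [CompleteSpace H] [RKHS ℝ H X ℝ]
    (hH : ∀ x y : X, RKHS.kernel H x y (1 : ℝ) = seKernel θU x y) (f : H) (z : X) :
    |f z| ≤ ‖f‖ := by
  have h1 : inner ℝ f (RKHS.kerFun H z (1 : ℝ)) = f z := by simp
  have h2 : ‖RKHS.kerFun H z (1 : ℝ)‖ ^ 2 = 1 := by
    have h3 := RKHS.kernel_inner H z z (1 : ℝ) (1 : ℝ)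
    rw [hH, seKernel_self] at h3
    rw [← real_inner_self_eq_norm_sq, ← h3]
    simp
  have h3 : ‖RKHS.kerFun H z (1 : ℝ)‖ = 1 :=
    (pow_eq_one_iff_of_nonneg (norm_nonneg _) two_ne_zero).1 h2
  rw [← h1]
  simpa [h3] using abs_real_inner_le_norm f (RKHS.kerFun H z (1 : ℝ))

lemma etaTerm_nonneg (hσ : 0 < σ) (hα : 0 < α) {m : ℝ} (hm : 0 ≤ m) {T : ℕ} (hT : 1 ≤ T) :
    0 ≤ etaTerm 1 m σ α g T := by
  have h1 := Real.rpow_nonneg hm g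
  have h2 := Real.rpow_nonneg (varRatio_pos hσ hα hT).le ((g - 1) / 2)
  unfold etaTerm
  positivity

lemma le_betaTerm {C₁ C₂ F m : ℝ} (hF : 0 ≤ F) {T : ℕ} :
    (2 * √2 + C₁ * tauInv g (tauArg σ α g T)) * m + etaTerm 1 m σ α g T ≤
      betaTerm 1 C₁ C₂ F m σ α g T := by
  have := mul_nonneg (Real.sqrt_nonneg (2 * C₂)) hF
  rw [betaTerm, ← tauArg]
  linarith

/-- The regret bound for `g = 0`, which holds surely. -/
lemma cumRegret_le_of_g_zero [Nonempty X] (hσ : 0 < σ) (hα : 0 < α) {C₁ C₂ F m B : ℝ}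
    (hC₁ : 0 < C₁) (hF : 0 ≤ F) (hm : 0 ≤ m) (hB : 0 ≤ B) {f : X → ℝ} (hf : ∀ z, |f z| ≤ B)
    (θL : Fin d → ℝ) {Ω : Type*} (x : ℕ → Ω → X) (xstar : X) (ω : Ω) {T : ℕ} (hT : 1 ≤ T) :
    cumRegret f xstar x T ω ≤
      (2 * B / √(min α (σ ^ 2) / σ ^ 2 * (1 / 2 * Real.log (1 + (σ ^ 2 / α)⁻¹)) / α) + 1) *
        (betaTerm 1 C₁ C₂ F m σ α 0 T * √(infoGain X σ α θL T * T / α)) := by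
  have hl : 0 < σ ^ 2 / α := by positivity
  -- The constant κ below comes from α(T-1) + σ² ≥ min(α, σ²) T; at `g = 0` it gives `etaTerm` ≥
  -- √(κT). The constant γ₁ is the gain of a single observation.
  have hT' : (1 : ℝ) ≤ T := by exact_mod_cast hT
  have hσ2 : 0 < σ ^ 2 := by positivity
  set κ := min α (σ ^ 2) / σ ^ 2 with hκ
  have hκ0 : 0 < κ := div_pos (lt_min hα hσ2) hσ2
  set γ₁ := 1 / 2 * Real.log (1 + (σ ^ 2 / α)⁻¹) with hγ₁
  have hγ₁0 : 0 < γ₁ := by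
    have := Real.log_pos (show 1 < 1 + (σ ^ 2 / α)⁻¹ by linarith [inv_pos.2 hl])
    positivity
  have h1 : cumRegret f xstar x T ω ≤ 2 * B * T := by
    rw [cumRegret]
    calc _ ≤ ∑ _t ∈ Finset.Icc 1 T, 2 * B := Finset.sum_le_sum fun t _ => by
          linarith [(abs_le.1 (hf xstar)).2, (abs_le.1 (hf (x t ω))).1]
      _ = 2 * B * T := by simp [mul_comm]
  have h2 : √(κ * T) ≤ betaTerm 1 C₁ C₂ F m σ α 0 T := by
    refine le_trans ?_ (le_betaTerm hF)
    have h3 : 0 ≤ (2 * √2 + C₁ * tauInv 0 (tauArg σ α 0 T)) * m := by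
      have := tauInv_nonneg le_rfl (tauArg_pos hσ hα le_rfl hT) (tauArg_le hσ hα le_rfl hT)
      positivity
    refine le_add_of_nonneg_of_le h3 ?_
    have hvr := varRatio_pos hσ hα hT
    rw [etaTerm, Real.rpow_zero, one_mul, one_mul, show ((0 : ℝ) - 1) / 2 = -(1 / 2) by norm_num,
      Real.rpow_neg hvr.le, ← Real.sqrt_eq_rpow, ← Real.sqrt_inv]
    refine Real.sqrt_le_sqrt ?_
    rw [varRatio, inv_div, hκ, div_mul_eq_mul_div]
    gcongr
    have h4 := min_le_left α (σ ^ 2)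
    have h5 := min_le_right α (σ ^ 2)
    nlinarith [mul_le_mul_of_nonneg_right h4 (show (0 : ℝ) ≤ T - 1 by linarith)]
  have h3 : √(γ₁ * T / α) ≤ √(infoGain X σ α θL T * T / α) := by
    have := le_infoGain (X := X) hl θL hT
    gcongr
  have h4 : √(κ * γ₁ / α) * T ≤
      betaTerm 1 C₁ C₂ F m σ α 0 T * √(infoGain X σ α θL T * T / α) := by
    refine le_trans (le_of_eq ?_) (mul_le_mul h2 h3 (Real.sqrt_nonneg _)
      ((Real.sqrt_nonneg _).trans h2))
    rw [← Real.sqrt_mul (by positivity), show κ * T * (γ₁ * T / α) = κ * γ₁ / α * (T : ℝ) ^ 2 by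
      ring, Real.sqrt_mul (by positivity), Real.sqrt_sq (by positivity)]
  have hpos : 0 < √(κ * γ₁ / α) := Real.sqrt_pos.2 (by positivity)
  refine h1.trans ?_
  have h5 : 0 ≤ √(κ * γ₁ / α) * T := by positivity
  calc 2 * B * T = 2 * B / √(κ * γ₁ / α) * (√(κ * γ₁ / α) * T) := by field_simp
    _ ≤ (2 * B / √(κ * γ₁ / α) + 1) * (√(κ * γ₁ / α) * T) := by
        refine mul_le_mul_of_nonneg_right (by linarith) h5
    _ ≤ _ := mul_le_mul_of_nonneg_left h4 (by positivity)

/-- The regret bound for `g > 0` on the event that the posterior means are uniformly close to the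
objective. -/
lemma cumRegret_le_of_g_pos [Nonempty X] (hX : IsCompact X) (hσ : 0 < σ) (hα : 0 < α)
    (hg : 0 < g) {δ : ℝ} (h0 : 0 < δ) (h1 : δ < 1) {C₁ C₂ C₀ F K : ℝ} (hC₁ : 0 < C₁) (hC₀ : 0 < C₀)
    (hF : 0 ≤ F) (hK : 0 ≤ K) {θL θU : Fin d → ℝ} (hL : ∀ i, 0 < θL i) {f : X → ℝ}
    {Ω : Type*} {mΩ : MeasurableSpace Ω} {P : Measure Ω} {ℱ : Filtration ℕ mΩ}
    {ε : ℕ → Ω → ℝ} {x : ℕ → Ω → X} {θ : ℕ → Ω → Fin d → ℝ} {ν : ℕ → Ω → ℝ}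
    (hrun : IsRun P σ α g δ C₁ C₀ θL θU f ℱ ε x θ ν) (xstar : X) {ω : Ω}
    (hf : ∀ t, 1 ≤ t → ∀ z : X,
      |f z - postMean σ α (θ t ω) (queries x (t - 1) ω) (responses f x ε (t - 1) ω) z| ≤
        K * mScale X σ α δ (θ t ω) t * postStd σ α (θ t ω) (queries x (t - 1) ω) z)
    {T : ℕ} (hT : 1 ≤ T) :
    cumRegret f xstar x T ω ≤
      ((K * ((gConst g / tau g (K * C₁)) ^ (1 / g) + 1) + C₀ / C₁) * √(2 * α * (σ ^ 2 / α + 1))) *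
        (betaTerm 1 C₁ C₂ F (mScale X σ α δ θL T) σ α g T *
          √(infoGain X σ α θL T * T / α)) := by
  have hl : 0 < σ ^ 2 / α := by positivity
  set K' := (gConst g / tau g (K * C₁)) ^ (1 / g) with hK'
  have hK'0 : 0 ≤ K' :=
    Real.rpow_nonneg (div_nonneg (gConst_pos hg.le).le (tau_pos hg.le _).le) _
  set m := mScale X σ α δ θL T with hm
  set I := tauInv g (tauArg σ α g T) with hI
  have hI0 : 0 ≤ I := tauInv_nonneg hg.le (tauArg_pos hσ hα hg.le hT) (tauArg_le hσ hα hg.le hT)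
  have hm0 : 0 ≤ m := (Real.sqrt_nonneg α).trans (sqrt_le_mScale h0 h1 θL hT)
  have hround : ∀ t ∈ Finset.Icc 1 T, f xstar - f (x t ω) ≤
      (K * (K' + 1) + C₀ * I) * m * postStd σ α θL (queries x (t - 1) ω) (x t ω) := by
    intro t ht
    obtain ⟨ht1, htT⟩ := Finset.mem_Icc.1 ht
    have hθ := hrun.theta_mem t ht1 ω
    set mt := mScale X σ α δ (θ t ω) t with hmt
    have hmt0 : 0 ≤ mt := (Real.sqrt_nonneg α).trans (sqrt_le_mScale h0 h1 _ ht1)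
    have hmtm : mt ≤ m := mScale_le_mScale hl h0 hL (fun i => (hθ i).1) ht1 htT
    have hν := hrun.nu_pos t ht1 ω
    -- The lower order condition on ν_t makes ρ = K C₁ work in every round.
    have hbρ : K * mt ≤ K * C₁ * ν t ω := by
      have h2 := (le_abs_self _).trans (hrun.nu_lower t ht1 ω)
      rw [← hmt, div_le_iff₀ hν] at h2
      rw [mul_assoc]
      exact mul_le_mul_of_nonneg_left h2 hK
    have h2 := instant_regret_le hX hσ hα hg hν (mul_nonneg hK hmt0) hbρ (hf t ht1) xstar (x t ω)
      (hrun.query_argmax t ht1 ω)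
    rw [← hK', Nat.sub_add_cancel ht1] at h2
    refine h2.trans ?_
    have hIt := tauInv_tauArg_mono hσ hα hg.le ht1 htT
    have hIt0 := tauInv_nonneg hg.le (tauArg_pos hσ hα hg.le ht1) (tauArg_le hσ hα hg.le ht1)
    rw [← hI] at hIt
    have hνm : ν t ω ≤ C₀ * m := (hrun.nu_upper t ht1 ω).trans (by gcongr)
    refine mul_le_mul ?_ ?_ (Real.sqrt_nonneg _) (by positivity)
    · have h3 : K * mt * (K' + 1) ≤ K * m * (K' + 1) := by gcongr
      have h4 : ν t ω * tauInv g (tauArg σ α g t) ≤ C₀ * m * I := by gcongr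
      linarith
    -- Passing to θL gives all rounds the same kernel, as summation requires.
    · exact Real.sqrt_le_sqrt (postCov_le_postCov _ _ hl hL fun i => (hθ i).1)
  have hsum : cumRegret f xstar x T ω ≤ (K * (K' + 1) + C₀ * I) * m *
      √(2 * (σ ^ 2 / α + 1) * (infoGain X σ α θL T * T)) := by
    refine (Finset.sum_le_sum hround).trans ?_
    rw [← Finset.mul_sum]
    exact mul_le_mul_of_nonneg_left (sum_postStd_le hl θL x T ω) (by positivity)
  have hsqrt : √(2 * (σ ^ 2 / α + 1) * (infoGain X σ α θL T * T)) =
      √(2 * α * (σ ^ 2 / α + 1)) * √(infoGain X σ α θL T * T / α) := by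
    rw [← Real.sqrt_mul (by positivity)]
    congr 1
    field_simp
  have hbeta : (2 * √2 + C₁ * I) * m ≤ betaTerm 1 C₁ C₂ F m σ α g T := by
    have h2 := le_betaTerm (σ := σ) (α := α) (g := g) (C₁ := C₁) (C₂ := C₂) (m := m) hF (T := T)
    have h3 := etaTerm_nonneg (g := g) hσ hα hm0 hT
    linarith
  -- The bracket of `betaTerm` dominates both summands: 2√2 ≥ 1 for the first, and C₀I = (C₀/C₁) ·
  -- C₁I for the second.
  have hA : K * (K' + 1) + C₀ * I ≤ (K * (K' + 1) + C₀ / C₁) * (2 * √2 + C₁ * I) := by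
    have h2 : (1 : ℝ) ≤ 2 * √2 := by
      have := Real.one_le_sqrt.2 (show (1 : ℝ) ≤ 2 by norm_num)
      linarith
    have h3 : C₀ / C₁ * (C₁ * I) = C₀ * I := by field_simp
    have h4 : 0 ≤ K * (K' + 1) := by positivity
    have h5 : 0 ≤ C₀ / C₁ * (2 * √2) := by positivity
    have h6 : 0 ≤ K * (K' + 1) * (C₁ * I) := by positivity
    have h7 := mul_le_mul_of_nonneg_left h2 h4
    linarith
  rw [hsqrt] at hsum
  refine hsum.trans ?_
  calc _ ≤ (K * (K' + 1) + C₀ / C₁) * (2 * √2 + C₁ * I) * m *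
        (√(2 * α * (σ ^ 2 / α + 1)) * √(infoGain X σ α θL T * T / α)) := by gcongr
    _ = (K * (K' + 1) + C₀ / C₁) * √(2 * α * (σ ^ 2 / α + 1)) *
        ((2 * √2 + C₁ * I) * m * √(infoGain X σ α θL T * T / α)) := by ring
    _ ≤ _ := by gcongr

end Main

end TemperedBO

end

theorem mainTheorem2 (g : ℝ) (hg0 : 0 ≤ g) (hg1 : g < 1) :
    ∃ Cg' : ℝ, 0 < Cg' ∧
    ∀ (d : ℕ) (X : Set (EuclideanSpace ℝ (Fin d))), IsCompact X →
    ∀ (θL θU : Fin d → ℝ), (∀ i, 0 < θL i) → (∀ i, θL i ≤ θU i) →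
    ∀ (σ α C₁ C₀ B : ℝ), 0 < σ → 0 < α → α ≤ 1 → 0 < C₁ → 0 < C₀ →
    ∃ C : ℝ, 0 < C ∧
    ∀ (H : Type*) [NormedAddCommGroup H] [InnerProductSpace ℝ H] [CompleteSpace H]
      [RKHS ℝ H X ℝ],
      (∀ x y : X, RKHS.kernel H x y (1 : ℝ) = TemperedBO.seKernel θU x y) →
    ∀ (f : H), ‖f‖ ≤ B →
    ∀ (xstar : X), (∀ z : X, f z ≤ f xstar) →
    ∀ (δ : ℝ), 0 < δ → δ < 1 →
    ∀ (Ω : Type*) [MeasurableSpace Ω] (P : MeasureTheory.Measure Ω)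
      [MeasureTheory.IsProbabilityMeasure P]
      (ℱ : MeasureTheory.Filtration ℕ ‹MeasurableSpace Ω›)
      (ε : ℕ → Ω → ℝ) (x : ℕ → Ω → X) (θ : ℕ → Ω → Fin d → ℝ) (ν : ℕ → Ω → ℝ),
      TemperedBO.IsRun P σ α g δ C₁ C₀ θL θU (fun z : X => f z) ℱ ε x θ ν →
      ENNReal.ofReal (1 - δ) ≤
        P {ω | ∀ T : ℕ, 1 ≤ T →
          TemperedBO.cumRegret (fun z : X => f z) xstar x T ω ≤
            C * (TemperedBO.betaTerm Cg' C₁ (∏ i, θU i / θL i) ‖f‖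
                  (TemperedBO.mScale X σ α δ θL T) σ α g T *
                √(TemperedBO.infoGain X σ α θL T * T / α))} := by
  open TemperedBO in
  -- `Cg' = 1` suffices: for `g > 0` only `etaTerm` ≥ 0 is used, and for `g = 0` its scale is
  -- absorbed into C.
  refine ⟨1, one_pos, fun d X hX θL θU hL hLU σ α C₁ C₀ B hσ hα _ hC₁ hC₀ => ?_⟩
  have hl : 0 < σ ^ 2 / α := by positivity
  rcases hg0.eq_or_lt with rfl | hg
  · refine ⟨2 * |B| / √(min α (σ ^ 2) / σ ^ 2 * (1 / 2 * Real.log (1 + (σ ^ 2 / α)⁻¹)) / α) + 1,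
      by positivity, ?_⟩
    intro H _ _ _ _ hH f hB xstar _ δ h0 h1 Ω _ P _ ℱ ε x θ ν _
    have : Nonempty X := ⟨xstar⟩
    have hall : {ω | ∀ T : ℕ, 1 ≤ T → cumRegret (fun z : X => f z) xstar x T ω ≤
        (2 * |B| / √(min α (σ ^ 2) / σ ^ 2 * (1 / 2 * Real.log (1 + (σ ^ 2 / α)⁻¹)) / α) + 1) *
          (betaTerm 1 C₁ (∏ i, θU i / θL i) ‖f‖ (mScale X σ α δ θL T) σ α 0 T *
            √(infoGain X σ α θL T * T / α))} = Set.univ := by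
      refine Set.eq_univ_of_forall fun ω T hT => ?_
      refine cumRegret_le_of_g_zero hσ hα hC₁ (norm_nonneg f) ?_ (abs_nonneg B)
        (fun z => (abs_apply_le_norm hH f z).trans (hB.trans (le_abs_self B))) θL x xstar ω hT
      exact (Real.sqrt_nonneg α).trans (sqrt_le_mScale h0 h1 θL hT)
    rw [hall, MeasureTheory.measure_univ]
    exact ENNReal.ofReal_le_one.2 (by linarith)
  · obtain ⟨D, hD⟩ := Metric.isBounded_iff.1 hX.isBounded
    have hD' : ∀ y ∈ X, ∀ z ∈ X, dist y z ≤ D := fun y hy z hz => hD hy hz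
    -- The noise constant plus the bias absorbed through `mScale` ≥ √α. Since C is fixed before f is
    -- known to exist, B may be negative here, hence |B|.
    set K := √(noiseConst σ α D θL θU) + √(∏ i, θU i / θL i) * |B| / √α with hK
    have hK0 : 0 ≤ K := by positivity
    have hτ := tau_pos hg.le (K * C₁)
    have hG := gConst_pos hg.le
    refine ⟨(K * ((gConst g / tau g (K * C₁)) ^ (1 / g) + 1) + C₀ / C₁) *
      √(2 * α * (σ ^ 2 / α + 1)), by positivity, ?_⟩
    intro H _ _ _ _ hH f hB xstar _ δ h0 h1 Ω _ P _ ℱ ε x θ ν hrun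
    have : Nonempty X := ⟨xstar⟩
    have hbad := measure_exists_likThreshold_le hσ hα hrun.noise_adapted hrun.noise_law
      hrun.noise_indep hrun.query_predictable h0 θL θU
    set S := {ω | ∃ (n : ℕ) (k : Fin d → Fin ((n + 1) ^ 2 + 1)), likThreshold d δ n ≤
      likRatio σ α (netPoint θL θU ((n + 1) ^ 2) k) (queries x n ω) (noises ε n ω)} with hS
    have hgood : ENNReal.ofReal (1 - δ) ≤ P Sᶜ := by
      have h2 : 1 ≤ P S + P Sᶜ := by
        rw [← MeasureTheory.measure_univ (μ := P), ← Set.union_compl_self S]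
        exact MeasureTheory.measure_union_le _ _
      rw [ENNReal.ofReal_sub _ h0.le, ENNReal.ofReal_one]
      refine tsub_le_iff_left.2 (h2.trans ?_)
      gcongr
    refine hgood.trans (MeasureTheory.measure_mono fun ω hω T hT => ?_)
    have hω' : ∀ (n : ℕ) k, likRatio σ α (netPoint θL θU ((n + 1) ^ 2) k) (queries x n ω)
        (noises ε n ω) < likThreshold d δ n := by
      intro n k
      by_contra hc
      exact hω ⟨n, k, not_lt.1 hc⟩
    refine cumRegret_le_of_g_pos hX hσ hα hg h0 h1 hC₁ hC₀ (norm_nonneg f) hK0 hL hrun xstar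
      (fun t ht z => ?_) hT
    -- Round t uses the posterior of n = t - 1 observations, and `mScale` at t uses the gain of n
    -- points.
    obtain ⟨n, rfl⟩ : ∃ n, t = n + 1 := ⟨t - 1, by omega⟩
    have hθ := hrun.theta_mem (n + 1) ht ω
    exact abs_sub_postMean_le hσ hα hD' hL (fun i => (hθ i).1) (fun i => (hθ i).2) h0 h1 hH
      (hB.trans (le_abs_self B)) (hω' n) z
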